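/- Let $X$ be a finite-dimensional real Hilbert space, $k\ge 1$, $s\in\mathbb R$, $f:X\times\mathbb R\to X$ and $J:X\times\mathbb R\to\mathbb R$. Let $\Lambda\subset X$ be a compact set, invariant under $\dot u=f(u,s)$ and uniformly hyperbolic: $f(\cdot,s)\neq0$ on $\Lambda$, and for $x\in\Lambda$ there is a splitting $X=E^s(x)\oplus\operatorname{span} f(x,s)\oplus E^u(x)$ whose stable and unstable parts are invariant under the tangent equation $\dot v=f_u v$ along the orbits in $\Lambda$, with $\|v(t)\|\le C\rho^{t-t_0}\|v(t_0)\|$ for $v\in E^s$ and $\|v(t_0)\|\le C\rho^{t-t_0}\|v(t)\|$ for $v\in E^u$ ($t\ge t_0$), for uniform $C$ and $\rho\in(0,1)$. Let $f,J$ be $C^{k+1}$ near $\Lambda\times\{s\}$. The unstable, neutral and stable adjoint subspaces at $x$ are $(E^s\oplus\operatorname{span} f)^\perp$, $(E^s\oplus E^u)^\perp$ and $(\operatorname{span} f\oplus E^u)^\perp$. Fix an orbit $u$ in $\Lambda$, let $n_u=\dim E^u(u(0))$, and suppose that $\bar J=\lim_{T\to\infty}\frac1T\int_0^TJ(u,s)\,dt$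 exists. Write $f(t)=f(u(t),s)$, $J(t)=J(u(t),s)$, $f_s(t)=\partial_sf(u(t),s)$, $J_s(t)=\partial_sJ(u(t),s)$. *Adjoint shadowing direction.* $\psi^\infty$ is the solution on $[0,\infty)$ of $$\frac{d\psi}{dt}+f_u^*\psi+J_u=0 \qquad (\ast)$$ that is bounded, has zero component in the unstable adjoint subspace at $t=0$, and satisfies $\lim_{T\to\infty}\frac1T\int_0^T\langle\psi^\infty,f\rangle\,dt=0$. *Discretization.* Equation $(\ast)$ is integrated backward by a one-step scheme of order $k$: a step of size $h$ from $t+h$ to $t$ is $\psi\mapsto A_{h,t}\psi+g_{h,t}$ (and $y\mapsto A_{h,t}y$ for the homogeneous equation), with $\|A_{h,t}\psi(t+h)+g_{h,t}-\psi(t)\|\le C(1+\|\psi(t+h)\|)h^{k+1}$ for all exact solutions $\psi$ of $(\ast)$ on $[t,t+h]$, all $t\ge0$ and all small $h>0$. For $T>0$ let $\Delta t=T/N$, $t_p=p\Delta t$. The integral over $[0,T]$ is discretized as $\int_{p=0}^NF\,dt:=\sum_{p=0}^Nw_pF(t_p)$ with $w_p\ge0$ and $\big|\int_{p=0}^NF\,dt-\int_0^TF\,dt\big|\le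 C_q\,T\,B\,\Delta t^k$ for every $F\in C^k[0,T]$ whose derivatives of orders $0,\dots,k$ are bounded by $B$. *Stabilized march.* Let $m\ge n_u$ and $M\ge0$, and choose grid indices $0=p_0<\dots<p_K=N<\dots<p_{K+L}=N+M$ (spin-up time $M\Delta t$). Let $Q_{K+L}$ have $m$ orthonormal columns orthogonal to $f(t_{N+M})$. For $i=K+L,\dots,1$, let $Y_i$ be the discrete homogeneous adjoint solution on segment $p_{i-1},\dots,p_i$ with terminal value $Q_i$, and take a QR decomposition $Y_i(t_{p_{i-1}})=Q_{i-1}R_{i-1}$. With $\gamma_K=(\bar J-J(T))f(T)/\|f(T)\|^2$, for $i=K,\dots,1$ let $v_i$ be the discrete solution of $(\ast)$ on segment $i$ with terminal value $\gamma_i$, and put $b_{i-1}=-Q_{i-1}^Tv_i(t_{p_{i-1}})$, $\gamma_{i-1}=v_i(t_{p_{i-1}})+Q_{i-1}b_{i-1}$. Let $a_0,\dots,a_K\in\mathbb R^m$ satisfy $R_{i-1}a_i=b_{i-1}+a_{i-1}$ for $i=1,\dots,K$, where the first $n_u$ entries of $a_0$ and the last $m-n_u$ entries of $a_K$ are $0$.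 The discrete adjoint is $\psi_p=Y_i(t_p)a_i+v_i(t_p)$ on segment $i\le K$. The initialization is called $c$-nondegenerate if every vector $q$ in the span of the first $n_u$ columns of $Q_{K+L}$ has distance at least $c\|q\|$ from the sum of the neutral and stable adjoint subspaces at $u(t_{N+M})$. *Claim.* Put $$\frac{d\bar J}{ds}\Big|_h=\frac1T\int_{p=0}^N\big(\langle\psi_p,f_s(t_p)\rangle+J_s(t_p)\big)dt,\qquad \frac{d\bar J^\infty}{ds}=\frac1T\int_0^T\big(\langle\psi^\infty,f_s\rangle+J_s\big)dt.$$ For all $c>0$ and $C_q$ there are constants $C_1,C_2,C_3$, independent of $T$, $N$, $M$, $m$, the segmentation, the initialization and the weights, such that for every $T>0$ there is $\delta>0$ (depending on $T$, but not on the choices just listed) with $$\Big|\frac{d\bar J}{ds}\Big|_h-\frac{d\bar J^\infty}{ds}\Big|\le\frac{C_1}{T}+(C_2+C_3T)\,\Delta t^k\qquad\text{whenever } 0<\Delta t=T/N<\delta,$$ for every such run of the stabilized march with a $c$-nondegenerate initialization and every such discretization of the integral. -/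

import Mathlib

open Set Filter Topology
open scoped RealInnerProductSpace

namespace ChaosAdjoint

variable {X : Type*} [NormedAddCommGroup X] [InnerProductSpace ℝ X]

/-- A complete orbit, contained in `Λ`, of the autonomous equation `du/dt = F u`. -/
def IsOrbit (F : X → X) (Λ : Set X) (u : ℝ → X) : Prop :=
  ∀ t : ℝ, u t ∈ Λ ∧ HasDerivAt u (F (u t)) t

/-- A solution of the tangent (variational) equation `dv/dt = F_u(u(t)) v` along `u`. -/
def IsTangentSolution (F : X → X) (u v : ℝ → X) : Prop :=
  ∀ t : ℝ, HasDerivAt v (fderiv ℝ F (u t) (v t)) t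

/-- `Λ` is a compact, invariant, uniformly hyperbolic set of the flow of `du/dt = F u`: the tangent
space at each point of `Λ` is the direct sum of a stable subspace `Es`, the one-dimensional neutral
subspace spanned by `F`, and an unstable subspace `Eu`. The stable and unstable subspaces are
invariant under the tangent equation, with uniform exponential rates. -/
structure IsUniformlyHyperbolic (F : X → X) (Λ : Set X) (Es Eu : X → Submodule ℝ X) : Prop where
  compact : IsCompact Λ
  invariant : ∀ x ∈ Λ, ∃ u : ℝ → X, IsOrbit F Λ u ∧ u 0 = x
  ne_zero : ∀ x ∈ Λ, F x ≠ 0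
  splitting : ∀ x ∈ Λ,
    DirectSum.IsInternal (![Es x, Submodule.span ℝ {F x}, Eu x] : Fin 3 → Submodule ℝ X)
  stable_invariant : ∀ u v : ℝ → X, IsOrbit F Λ u → IsTangentSolution F u v →
    ∀ t₀ t : ℝ, v t₀ ∈ Es (u t₀) → v t ∈ Es (u t)
  unstable_invariant : ∀ u v : ℝ → X, IsOrbit F Λ u → IsTangentSolution F u v →
    ∀ t₀ t : ℝ, v t₀ ∈ Eu (u t₀) → v t ∈ Eu (u t)
  rates : ∃ C ρ : ℝ, 0 < ρ ∧ ρ < 1 ∧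
    ∀ u v : ℝ → X, IsOrbit F Λ u → IsTangentSolution F u v → ∀ t₀ t : ℝ, t₀ ≤ t →
      (v t₀ ∈ Es (u t₀) → ‖v t‖ ≤ C * ρ ^ (t - t₀) * ‖v t₀‖) ∧
      (v t ∈ Eu (u t) → ‖v t₀‖ ≤ C * ρ ^ (t - t₀) * ‖v t‖)

/-- The neutral adjoint subspace at `x`. The adjoint splitting is the dual of the tangent splitting:
each adjoint subspace is the annihilator of the other two tangent subspaces. -/
noncomputable def adjNeutral (Es Eu : X → Submodule ℝ X) (x : X) : Submodule ℝ X :=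
  (Es x ⊔ Eu x)ᗮ

/-- The stable adjoint subspace at `x`. -/
noncomputable def adjStable (F : X → X) (Eu : X → Submodule ℝ X) (x : X) : Submodule ℝ X :=
  (Submodule.span ℝ {F x} ⊔ Eu x)ᗮ

/-- The covectors at `x` whose component `w⁺` in the unstable adjoint subspace
`(Es x ⊔ span {F x})ᗮ` vanishes, i.e. the sum of the neutral and stable adjoint subspaces. -/
noncomputable def adjCenterStable (F : X → X) (Es Eu : X → Submodule ℝ X) (x : X) : Submodule ℝ X :=
  adjNeutral Es Eu x ⊔ adjStable F Eu x

section Adjoint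

variable [CompleteSpace X]

/-- `ψ` solves the adjoint equation `dψ/dt + f_u^* ψ + J_u = 0` along `u` on the time set `S`. -/
def IsAdjointSolutionOn (f : X → ℝ → X) (J : X → ℝ → ℝ) (s : ℝ) (u : ℝ → X) (S : Set ℝ)
    (ψ : ℝ → X) : Prop :=
  ∀ t ∈ S, HasDerivWithinAt ψ
    (-(ContinuousLinearMap.adjoint (fderiv ℝ (fun x => f x s) (u t)) (ψ t))
      - gradient (fun x => J x s) (u t)) S t

/-- The adjoint shadowing direction `ψ^∞` along the orbit `u`. -/
structure IsAdjointShadowing (f : X → ℝ → X) (J : X → ℝ → ℝ) (s : ℝ) (Es Eu : X → Submodule ℝ X)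
    (u : ℝ → X) (ψ : ℝ → X) : Prop where
  adjoint_eq : IsAdjointSolutionOn f J s u (Ici 0) ψ
  bounded : ∃ B : ℝ, ∀ t : ℝ, 0 ≤ t → ‖ψ t‖ ≤ B
  unstable_zero : ψ 0 ∈ adjCenterStable (fun x => f x s) Es Eu (u 0)
  neutral_mean : Tendsto (fun T : ℝ => (1 / T) * ∫ t in (0 : ℝ)..T, ⟪ψ t, f (u t) s⟫) atTop (𝓝 0)

/-- A one-step time integration scheme for the (linear, inhomogeneous) adjoint equation, run
backward in time: the step of size `h` from `t + h` to `t` is `ψ ↦ A h t ψ + g h t`. The same scheme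
applied to the homogeneous adjoint equation is `y ↦ A h t y`. -/
structure AdjointScheme (X : Type*) [NormedAddCommGroup X] [InnerProductSpace ℝ X] where
  A : ℝ → ℝ → X →L[ℝ] X
  g : ℝ → ℝ → X

/-- The scheme has order `k` for the adjoint equation along `u`: the local truncation error is
`O(h ^ (k + 1))`, uniformly in time. -/
def AdjointScheme.HasOrder (S : AdjointScheme X) (k : ℕ) (f : X → ℝ → X) (J : X → ℝ → ℝ) (s : ℝ)
    (u : ℝ → X) : Prop :=
  ∃ C h₀ : ℝ, 0 < h₀ ∧ ∀ h : ℝ, 0 < h → h < h₀ → ∀ t : ℝ, 0 ≤ t → ∀ ψ : ℝ → X,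
    IsAdjointSolutionOn f J s u (Icc t (t + h)) ψ →
      ‖S.A h t (ψ (t + h)) + S.g h t - ψ t‖ ≤ C * (1 + ‖ψ (t + h)‖) * h ^ (k + 1)

end Adjoint

/-- A run of the discretized stabilized march on `[0, T]` with `N` steps of size `h = T / N`, spin-up
time `M * h` beyond `T`, and `m` homogeneous adjoint solutions, of which the first `nu` are kept as
the unstable ones (`m = nu` is the basic march). Grid point `p` is the time `p * h`. The segment `i`
consists of the grid points `brk i, …, brk (i + 1)`; the segments `0, …, K - 1` cover `[0, T]` and
the segments `K, …, K + L - 1` cover the spin-up interval. -/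
structure StabilizedMarch (f : X → ℝ → X) (J : X → ℝ → ℝ) (s Jbar : ℝ) (u : ℝ → X)
    (S : AdjointScheme X) (T : ℝ) (N M nu m : ℕ) where
  K : ℕ
  L : ℕ
  brk : ℕ → ℕ
  brk_zero : brk 0 = 0
  brk_K : brk K = N
  brk_end : brk (K + L) = N + M
  brk_lt : ∀ i < K + L, brk i < brk (i + 1)
  /-- orthonormal columns at the break points; `Q (K + L)` is the initialization -/
  Q : ℕ → Fin m → X
  /-- homogeneous solutions: `Y i p` is `Y_i` at grid point `p` -/
  Y : ℕ → ℕ → Fin m → X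
  /-- triangular factors -/
  R : ℕ → Matrix (Fin m) (Fin m) ℝ
  /-- terminal values of the particular solutions -/
  γ : ℕ → X
  /-- particular solutions: `v i p` is `v_i` at grid point `p` -/
  v : ℕ → ℕ → X
  b : ℕ → Fin m → ℝ
  a : ℕ → Fin m → ℝ
  /-- the discrete adjoint solution at the grid points `0, …, N` -/
  ψ : ℕ → X
  Q_orthonormal : ∀ i ≤ K + L, Orthonormal ℝ (Q i)
  Q_init : ∀ j, ⟪Q (K + L) j, f (u (((N + M : ℕ) : ℝ) * (T / N))) s⟫ = 0
  Y_terminal : ∀ i < K + L, ∀ j, Y i (brk (i + 1)) j = Q (i + 1) j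
  Y_step : ∀ i < K + L, ∀ p, brk i ≤ p → p < brk (i + 1) → ∀ j,
    Y i p j = S.A (T / N) (p * (T / N)) (Y i (p + 1) j)
  R_upper : ∀ i < K + L, ∀ l j : Fin m, j < l → R i l j = 0
  qr : ∀ i < K + L, ∀ j, Y i (brk i) j = ∑ l, R i l j • Q i l
  γ_terminal : γ K = ((Jbar - J (u T) s) / ‖f (u T) s‖ ^ 2) • f (u T) s
  v_terminal : ∀ i < K, v i (brk (i + 1)) = γ (i + 1)
  v_step : ∀ i < K, ∀ p, brk i ≤ p → p < brk (i + 1) →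
    v i p = S.A (T / N) (p * (T / N)) (v i (p + 1)) + S.g (T / N) (p * (T / N))
  b_eq : ∀ i < K, ∀ j, b i j = -⟪Q i j, v i (brk i)⟫
  γ_eq : ∀ i < K, γ i = v i (brk i) + ∑ j, b i j • Q i j
  march : ∀ i < K, (R i).mulVec (a (i + 1)) = b i + a i
  a_terminal : ∀ j : Fin m, nu ≤ (j : ℕ) → a K j = 0
  a_initial : ∀ j : Fin m, (j : ℕ) < nu → a 0 j = 0
  ψ_eq : ∀ i < K, ∀ p, brk i ≤ p → p ≤ brk (i + 1) →
    ψ p = (∑ j, a (i + 1) j • Y i p j) + v i p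

/-- The initialization of the homogeneous solutions is `c`-nondegenerate: every vector in the span of
its first `nu` columns makes an angle with sine at least `c` with the sum of the neutral and stable
adjoint subspaces, i.e. has a nonnegligible component along the unstable adjoint subspace. -/
def StabilizedMarch.Nondegenerate {f : X → ℝ → X} {J : X → ℝ → ℝ} {s Jbar : ℝ} {u : ℝ → X}
    {S : AdjointScheme X} {T : ℝ} {N M nu m : ℕ} (P : StabilizedMarch f J s Jbar u S T N M nu m)
    (Es Eu : X → Submodule ℝ X) (c : ℝ) : Prop :=
  ∀ q ∈ Submodule.span ℝ (P.Q (P.K + P.L) '' {j | (j : ℕ) < nu}),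
    ∀ w ∈ adjCenterStable (fun x => f x s) Es Eu (u (((N + M : ℕ) : ℝ) * (T / N))),
      c * ‖q‖ ≤ ‖q - w‖

/-- `w 0, …, w N` are the weights of a discretization `∑ p, w p * F (p * h)`, with `h = T / N`, of
`∫ t in 0..T, F t` that is of order `h ^ k` with constant `Cq`. -/
structure IsQuadrature (Cq : ℝ) (k : ℕ) (T : ℝ) (N : ℕ) (w : ℕ → ℝ) : Prop where
  nonneg : ∀ p ≤ N, 0 ≤ w p
  error : ∀ (F : ℝ → ℝ) (B : ℝ), ContDiffOn ℝ k F (Icc 0 T) →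
    (∀ j ≤ k, ∀ t ∈ Icc 0 T, |iteratedDerivWithin j F (Icc 0 T) t| ≤ B) →
    |(∑ p ∈ Finset.range (N + 1), w p * F (p * (T / N))) - ∫ t in (0 : ℝ)..T, F t|
      ≤ Cq * T * B * (T / N) ^ k

/-- The sensitivity computed from the grid function `ψ` with the weights `w`. -/
noncomputable def discreteSensitivity (f : X → ℝ → X) (J : X → ℝ → ℝ) (s : ℝ) (u : ℝ → X) (T : ℝ)
    (N : ℕ) (w : ℕ → ℝ) (ψ : ℕ → X) : ℝ :=
  (1 / T) * ∑ p ∈ Finset.range (N + 1),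
    w p * (⟪ψ p, deriv (fun σ => f (u (p * (T / N))) σ) s⟫
      + deriv (fun σ => J (u (p * (T / N))) σ) s)

/-- The sensitivity computed over `[0, T]` from the continuous-time adjoint `ψ`. -/
noncomputable def continuousSensitivity (f : X → ℝ → X) (J : X → ℝ → ℝ) (s : ℝ) (u : ℝ → X) (T : ℝ)
    (ψ : ℝ → X) : ℝ :=
  (1 / T) * ∫ t in (0 : ℝ)..T,
    (⟪ψ t, deriv (fun σ => f (u t) σ) s⟫ + deriv (fun σ => J (u t) σ) s)

end ChaosAdjoint

namespace ChaosAdjoint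

section LinearODE

variable {E : Type*} [NormedAddCommGroup E] [NormedSpace ℝ E]

/-- The terms of the Picard series of the linear equation `z' = B z`, `z 0 = z₀`. -/
noncomputable def picardTerm (B : ℝ → E →L[ℝ] E) (z₀ : E) : ℕ → ℝ → E
  | 0 => fun _ => z₀
  | n + 1 => fun t => ∫ τ in (0 : ℝ)..t, B τ (picardTerm B z₀ n τ)

theorem continuous_picardTerm {B : ℝ → E →L[ℝ] E} (hB : Continuous B) (z₀ : E) (n : ℕ) :
    Continuous (picardTerm B z₀ n) := by
  induction n with
  | zero => exact continuous_const
  | succ n ih =>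
    exact intervalIntegral.continuous_primitive
      (fun a b => (hB.clm_apply ih).intervalIntegrable a b) 0

theorem hasDerivAt_picardTerm_succ [CompleteSpace E] {B : ℝ → E →L[ℝ] E} (hB : Continuous B)
    (z₀ : E) (n : ℕ) (t : ℝ) :
    HasDerivAt (picardTerm B z₀ (n + 1)) (B t (picardTerm B z₀ n t)) t := by
  have hc := hB.clm_apply (continuous_picardTerm hB z₀ n)
  exact intervalIntegral.integral_hasDerivAt_right (hc.intervalIntegrable 0 t)
    hc.stronglyMeasurable.stronglyMeasurableAtFilter hc.continuousAt

theorem norm_picardTerm_le {B : ℝ → E →L[ℝ] E} {L : ℝ}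
    (hL : ∀ t, ‖B t‖ ≤ L) (z₀ : E) (n : ℕ) (t : ℝ) :
    ‖picardTerm B z₀ n t‖ ≤ ‖z₀‖ * ((L * |t|) ^ n / n.factorial) := by
  have hL0 : 0 ≤ L := (norm_nonneg _).trans (hL 0)
  induction n generalizing t with
  | zero => simp [picardTerm]
  | succ n ih =>
    have hb : ∀ τ, ‖B τ (picardTerm B z₀ n τ)‖ ≤ L * (‖z₀‖ * ((L * |τ|) ^ n / n.factorial)) :=
      fun τ => (B τ).le_of_opNorm_le_of_le (hL τ) (ih τ)
    have h1 : ‖picardTerm B z₀ (n + 1) t‖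
        ≤ |∫ τ in (0 : ℝ)..t, L * (‖z₀‖ * ((L * |τ|) ^ n / n.factorial))| := by
      refine intervalIntegral.norm_integral_le_abs_of_norm_le
        (Eventually.of_forall fun τ => hb τ) ?_
      exact Continuous.intervalIntegrable (by fun_prop) _ _
    refine h1.trans (le_of_eq ?_)
    have h2 : (∫ τ in (0 : ℝ)..t, L * (‖z₀‖ * ((L * |τ|) ^ n / n.factorial)))
        = (L ^ (n + 1) * ‖z₀‖ / n.factorial) * ∫ τ in (0 : ℝ)..t, |τ| ^ n := by
      rw [← intervalIntegral.integral_const_mul]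
      congr 1
      ext τ
      rw [mul_pow]
      ring
    have h3 : |∫ τ in (0 : ℝ)..t, |τ| ^ n| = |t| ^ (n + 1) / (n + 1) := by
      rw [intervalIntegral.abs_intervalIntegral_eq]
      have := integral_pow_abs_sub_uIoc (a := 0) (b := t) (n := n)
      simp only [sub_zero] at this
      rw [this, abs_of_nonneg (by positivity)]
    rw [h2, abs_mul, h3, abs_of_nonneg (by positivity), Nat.factorial_succ, mul_pow]
    push_cast
    field_simp

theorem exists_linear_solution [CompleteSpace E] {B : ℝ → E →L[ℝ] E} (hB : Continuous B) {L : ℝ}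
    (hL : ∀ t, ‖B t‖ ≤ L) (z₀ : E) :
    ∃ z : ℝ → E, z 0 = z₀ ∧ ∀ t, HasDerivAt z (B t (z t)) t := by
  have hL0 : 0 ≤ L := (norm_nonneg _).trans (hL 0)
  have hsum : ∀ t, Summable fun n => picardTerm B z₀ n t := fun t =>
    Summable.of_norm_bounded ((Real.summable_pow_div_factorial (L * |t|)).mul_left ‖z₀‖)
      fun n => norm_picardTerm_le hL z₀ n t
  refine ⟨fun t => ∑' n, picardTerm B z₀ n t, ?_, fun t => ?_⟩
  · change ∑' n, picardTerm B z₀ n 0 = z₀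
    rw [tsum_eq_single 0]
    · rfl
    · rintro (_ | n) hn
      · exact absurd rfl hn
      · simp [picardTerm]
  · set g' : ℕ → ℝ → E := fun n => Nat.casesOn n (fun _ => 0)
      (fun n t => B t (picardTerm B z₀ n t)) with hg'
    set R : ℝ := |t| + 1 with hR
    set b : ℕ → ℝ := fun n => Nat.casesOn n 0
      (fun n => L * (‖z₀‖ * ((L * R) ^ n / n.factorial))) with hb
    have hbs : Summable b := by
      rw [← summable_nat_add_iff 1]
      exact ((Real.summable_pow_div_factorial (L * R)).mul_left ‖z₀‖).mul_left L
    have key := hasDerivAt_tsum_of_isPreconnected (𝕜 := ℝ) (g := picardTerm B z₀) (g' := g')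
      (u := b) (t := Ioo (-R) R) (y₀ := t) (y := t) hbs isOpen_Ioo isPreconnected_Ioo
      (by
        rintro (_ | n) y -
        · exact hasDerivAt_const y z₀
        · exact hasDerivAt_picardTerm_succ hB z₀ n y)
      (by
        rintro (_ | n) y hy
        · simp [hg', hb]
        · have hyR : |y| ≤ R := (abs_lt.2 hy).le
          refine ((B y).le_of_opNorm_le_of_le (hL y) (norm_picardTerm_le hL z₀ n y)).trans ?_
          simp only [hb]
          gcongr)
      (abs_lt.1 (by rw [hR]; linarith)) (hsum t) (abs_lt.1 (by rw [hR]; linarith))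
    convert key using 1
    have hg's : Summable fun n => g' n t := by
      rw [← summable_nat_add_iff 1]
      exact (hsum t).mapL (B t)
    rw [hg's.tsum_eq_zero_add, (B t).map_tsum (hsum t)]
    simp [hg']

/-- A fundamental solution of `v' = A v`, together with its inverse. -/
theorem exists_fundamental_solution {X : Type*} [NormedAddCommGroup X] [NormedSpace ℝ X]
    [FiniteDimensional ℝ X] {A : ℝ → X →L[ℝ] X} (hA : Continuous A) {L : ℝ}
    (hL : ∀ t, ‖A t‖ ≤ L) :
    ∃ Z W : ℝ → X →L[ℝ] X, (∀ t, HasDerivAt Z (A t ∘L Z t) t) ∧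
      (∀ t, HasDerivAt W (-(W t ∘L A t)) t) ∧
      (∀ t x, Z t (W t x) = x) ∧ ∀ t x, W t (Z t x) = x := by
  have : CompleteSpace X := FiniteDimensional.complete ℝ X
  obtain ⟨Z, hZ0, hZ⟩ := exists_linear_solution (E := X →L[ℝ] X)
    (B := fun t => ContinuousLinearMap.compL ℝ X X X (A t))
    ((ContinuousLinearMap.compL ℝ X X X).continuous.comp hA)
    (L := L) (fun t => (ContinuousLinearMap.opNorm_le_bound _ ((norm_nonneg _).trans (hL t))
      fun z => (ContinuousLinearMap.opNorm_comp_le _ _).trans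
        (mul_le_mul_of_nonneg_right (hL t) (norm_nonneg _)))) (ContinuousLinearMap.id ℝ X)
  obtain ⟨W, hW0, hW⟩ := exists_linear_solution (E := X →L[ℝ] X)
    (B := fun t => -((ContinuousLinearMap.compL ℝ X X X).flip (A t)))
    ((ContinuousLinearMap.compL ℝ X X X).flip.continuous.comp hA).neg
    (L := L) (fun t => (ContinuousLinearMap.opNorm_le_bound _ ((norm_nonneg _).trans (hL t))
      fun z => by
        simp only [neg_apply, ContinuousLinearMap.flip_apply, norm_neg,
          ContinuousLinearMap.compL_apply]
        refine (ContinuousLinearMap.opNorm_comp_le _ _).trans ?_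
        rw [mul_comm]
        exact mul_le_mul_of_nonneg_right (hL t) (norm_nonneg _))) (ContinuousLinearMap.id ℝ X)
  simp only [ContinuousLinearMap.compL_apply, neg_apply,
    ContinuousLinearMap.flip_apply] at hZ hW
  have hWZ : ∀ t, W t ∘L Z t = ContinuousLinearMap.id ℝ X := by
    have hd : ∀ t, HasDerivAt (fun t => W t ∘L Z t) 0 t := fun t => by
      have := (hW t).clm_comp (hZ t)
      refine this.congr_deriv ?_
      ext x
      simp
    intro t
    rw [is_const_of_deriv_eq_zero (fun t => (hd t).differentiableAt) (fun t => (hd t).deriv) t 0,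
      hW0, hZ0]
    rfl
  have hWZ' : ∀ t x, W t (Z t x) = x := fun t x => by
    simpa using DFunLike.congr_fun (hWZ t) x
  refine ⟨Z, W, hZ, hW, fun t x => ?_, hWZ'⟩
  have hinj : Function.Injective (Z t : X →ₗ[ℝ] X) := fun a b h => by
    rw [← hWZ' t a, ← hWZ' t b]; exact congrArg _ h
  obtain ⟨y, rfl⟩ := LinearMap.injective_iff_surjective.1 hinj x
  simp [hWZ']

end LinearODE

section Cocycle

variable {X : Type*} [NormedAddCommGroup X] [InnerProductSpace ℝ X]

/-- An evolution family `Φ t r` (from time `r` to time `t`) with invariant stable and unstable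
subspaces of uniform rate, and a bounded invariant vector field `φ` spanning the neutral
direction. -/
structure IsDichotomy (Φ : ℝ → ℝ → X →L[ℝ] X) (Vs Vu : ℝ → Submodule ℝ X) (φ : ℝ → X)
    (C μ M : ℝ) : Prop where
  one_le : 1 ≤ C
  rate_pos : 0 < μ
  self : ∀ t x, Φ t t x = x
  comp : ∀ t r q x, Φ t r (Φ r q x) = Φ t q x
  field : ∀ t r, Φ t r (φ r) = φ t
  field_le : ∀ t, ‖φ t‖ ≤ M
  stable_map : ∀ t r, ∀ v ∈ Vs r, Φ t r v ∈ Vs t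
  unstable_map : ∀ t r, ∀ v ∈ Vu r, Φ t r v ∈ Vu t
  stable_rate : ∀ t r, r ≤ t → ∀ v ∈ Vs r, ‖Φ t r v‖ ≤ C * Real.exp (-μ * (t - r)) * ‖v‖
  unstable_rate : ∀ t r, r ≤ t → ∀ v ∈ Vu t, ‖Φ r t v‖ ≤ C * Real.exp (-μ * (t - r)) * ‖v‖

/-- Every vector splits along the dichotomy with components of norm at most `K` times its own. -/
def HasBoundedSplitting (Vs Vu : ℝ → Submodule ℝ X) (φ : ℝ → X) (K : ℝ) : Prop :=
  ∀ t v, ∃ vs ∈ Vs t, ∃ α : ℝ, ∃ vu ∈ Vu t, v = vs + α • φ t + vu ∧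
    ‖vs‖ ≤ K * ‖v‖ ∧ |α| ≤ K * ‖v‖ ∧ ‖vu‖ ≤ K * ‖v‖

variable {Φ : ℝ → ℝ → X →L[ℝ] X} {Vs Vu : ℝ → Submodule ℝ X} {φ : ℝ → X} {C μ M : ℝ}

theorem exists_exp_decay_le (hμ : 0 < μ) (a : ℝ) {ε : ℝ} (hε : 0 < ε) :
    ∃ τ : ℝ, 0 ≤ τ ∧ a * Real.exp (-μ * τ) ≤ ε := by
  have h : Tendsto (fun τ : ℝ => a * Real.exp (-μ * τ)) atTop (𝓝 (a * 0)) := by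
    refine (Real.tendsto_exp_atBot.comp ?_).const_mul a
    exact tendsto_id.const_mul_atTop_of_neg (by linarith)
  rw [mul_zero] at h
  obtain ⟨τ, h1, h2⟩ := ((h.eventually (gt_mem_nhds hε)).and (eventually_ge_atTop 0)).exists
  exact ⟨τ, h2, h1.le⟩

theorem IsDichotomy.hasBoundedSplitting (D : IsDichotomy Φ Vs Vu φ C μ M) {L m : ℝ} (hm : 0 < m)
    (hφ : ∀ t, m ≤ ‖φ t‖)
    (hgrowth : ∀ t r, r ≤ t → ∀ x, ‖Φ t r x‖ ≤ Real.exp (L * (t - r)) * ‖x‖)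
    (hsplit : ∀ t v, ∃ vs ∈ Vs t, ∃ α : ℝ, ∃ vu ∈ Vu t, v = vs + α • φ t + vu) :
    ∃ K : ℝ, 0 ≤ K ∧ HasBoundedSplitting Vs Vu φ K := by
  have hC := D.one_le
  have hM : 0 < M := hm.trans_le ((hφ 0).trans (D.field_le 0))
  have hneutral : ∃ K₁ : ℝ, 0 ≤ K₁ ∧ ∀ t, ∀ vs ∈ Vs t, ∀ α : ℝ, |α| ≤ K₁ * ‖vs + α • φ t‖ := by
    obtain ⟨τ, hτ, hτm⟩ := exists_exp_decay_le D.rate_pos (C * M) (half_pos hm)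
    refine ⟨(Real.exp (L * τ) + C) * (2 / m), by positivity, fun t vs hvs α => ?_⟩
    set z := vs + α • φ t with hz
    have h1 : ‖vs‖ ≤ ‖z‖ + |α| * M := by
      have : vs = z - α • φ t := by rw [hz]; abel
      rw [this]
      refine (norm_sub_le _ _).trans ?_
      rw [norm_smul, Real.norm_eq_abs]
      gcongr
      exact D.field_le t
    have h2 : |α| * m ≤ Real.exp (L * τ) * ‖z‖ + C * Real.exp (-μ * τ) * ‖vs‖ := by
      have e : α • φ (t + τ) = Φ (t + τ) t z - Φ (t + τ) t vs := by
        rw [hz, map_add, map_smul, D.field]; abel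
      have g1 := hgrowth (t + τ) t (by linarith) z
      have g2 := D.stable_rate (t + τ) t (by linarith) vs hvs
      rw [add_sub_cancel_left] at g1 g2
      calc |α| * m ≤ |α| * ‖φ (t + τ)‖ := by gcongr; exact hφ _
        _ = ‖Φ (t + τ) t z - Φ (t + τ) t vs‖ := by rw [← e, norm_smul, Real.norm_eq_abs]
        _ ≤ _ := (norm_sub_le _ _).trans (add_le_add g1 g2)
    have hexp : Real.exp (-μ * τ) ≤ 1 := Real.exp_le_one_iff.2 (by nlinarith [D.rate_pos])
    have h3 : C * Real.exp (-μ * τ) * ‖vs‖ ≤ C * ‖z‖ + |α| * (m / 2) := by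
      calc C * Real.exp (-μ * τ) * ‖vs‖ ≤ C * Real.exp (-μ * τ) * (‖z‖ + |α| * M) := by gcongr
        _ = C * Real.exp (-μ * τ) * ‖z‖ + |α| * (C * M * Real.exp (-μ * τ)) := by ring
        _ ≤ C * 1 * ‖z‖ + |α| * (m / 2) := by gcongr
        _ = _ := by ring
    have h4 : |α| * (m / 2) ≤ (Real.exp (L * τ) + C) * ‖z‖ := by linarith
    calc |α| = |α| * (m / 2) * (2 / m) := by field_simp
      _ ≤ (Real.exp (L * τ) + C) * ‖z‖ * (2 / m) := by gcongr
      _ = _ := by ring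
  obtain ⟨K₁, hK₁, hneutral⟩ := hneutral
  have hstable : ∀ t, ∀ vs ∈ Vs t, ∀ α : ℝ, ‖vs‖ ≤ (1 + K₁ * M) * ‖vs + α • φ t‖ := by
    intro t vs hvs α
    have : vs = (vs + α • φ t) - α • φ t := by abel
    calc ‖vs‖ = ‖(vs + α • φ t) - α • φ t‖ := by rw [← this]
      _ ≤ ‖vs + α • φ t‖ + |α| * ‖φ t‖ := by
        rw [← Real.norm_eq_abs, ← norm_smul]; exact norm_sub_le _ _
      _ ≤ ‖vs + α • φ t‖ + K₁ * ‖vs + α • φ t‖ * M := by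
        gcongr
        · exact hneutral t vs hvs α
        · exact D.field_le t
      _ = _ := by ring
  set K₂ := C * (1 + K₁ * M) + K₁ * M with hK₂
  have hforward : ∀ t τ, 0 ≤ τ → ∀ vs ∈ Vs t, ∀ α : ℝ,
      ‖Φ (t + τ) t (vs + α • φ t)‖ ≤ K₂ * ‖vs + α • φ t‖ := by
    intro t τ hτ vs hvs α
    have hexp : Real.exp (-μ * τ) ≤ 1 := Real.exp_le_one_iff.2 (by nlinarith [D.rate_pos])
    have g := D.stable_rate (t + τ) t (by linarith) vs hvs
    rw [add_sub_cancel_left] at g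
    rw [map_add, map_smul, D.field]
    calc ‖Φ (t + τ) t vs + α • φ (t + τ)‖ ≤ ‖Φ (t + τ) t vs‖ + |α| * ‖φ (t + τ)‖ := by
          rw [← Real.norm_eq_abs, ← norm_smul]; exact norm_add_le _ _
      _ ≤ C * 1 * ((1 + K₁ * M) * ‖vs + α • φ t‖) + K₁ * ‖vs + α • φ t‖ * M := by
          gcongr
          · exact g.trans (by gcongr; exact hstable t vs hvs α)
          · exact hneutral t vs hvs α
          · exact D.field_le _
      _ = _ := by rw [hK₂]; ring
  obtain ⟨τ, hτ, hτK⟩ := exists_exp_decay_le D.rate_pos (C * K₂) (half_pos one_pos)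
  have hexp : Real.exp (-μ * τ) ≤ 1 := Real.exp_le_one_iff.2 (by nlinarith [D.rate_pos])
  set K₃ := 2 * (C * Real.exp (L * τ) + 1 / 2) with hK₃
  have hK₃0 : 0 ≤ K₃ := by positivity
  have hunstable : ∀ t, ∀ vs ∈ Vs t, ∀ α : ℝ, ∀ vu ∈ Vu t,
      ‖vu‖ ≤ K₃ * ‖vs + α • φ t + vu‖ := by
    intro t vs hvs α vu hvu
    set z := vs + α • φ t with hz
    have hzle : ‖z‖ ≤ ‖z + vu‖ + ‖vu‖ := by
      simpa using norm_sub_le (z + vu) vu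
    have g1 := D.unstable_rate (t + τ) t (by linarith) _ (D.unstable_map (t + τ) t vu hvu)
    rw [D.comp, D.self, add_sub_cancel_left] at g1
    have g2 : ‖Φ (t + τ) t vu‖ ≤ Real.exp (L * τ) * ‖z + vu‖ + K₂ * ‖z‖ := by
      have e : Φ (t + τ) t vu = Φ (t + τ) t (z + vu) - Φ (t + τ) t z := by
        rw [map_add]; abel
      rw [e]
      refine (norm_sub_le _ _).trans (add_le_add ?_ (hforward t τ hτ vs hvs α))
      simpa using hgrowth (t + τ) t (by linarith) (z + vu)
    have g3 : ‖vu‖ ≤ C * Real.exp (L * τ) * ‖z + vu‖ + 1 / 2 * ‖z‖ := by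
      calc ‖vu‖ ≤ C * Real.exp (-μ * τ) * (Real.exp (L * τ) * ‖z + vu‖ + K₂ * ‖z‖) :=
            g1.trans (by gcongr)
        _ = C * Real.exp (-μ * τ) * (Real.exp (L * τ) * ‖z + vu‖)
            + C * K₂ * Real.exp (-μ * τ) * ‖z‖ := by ring
        _ ≤ C * 1 * (Real.exp (L * τ) * ‖z + vu‖) + 1 / 2 * ‖z‖ := by gcongr
        _ = _ := by ring
    rw [hK₃]
    nlinarith
  refine ⟨(1 + K₁ * M + K₁) * (1 + K₃) + K₃, by positivity, fun t v => ?_⟩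
  obtain ⟨vs, hvs, α, vu, hvu, rfl⟩ := hsplit t v
  refine ⟨vs, hvs, α, vu, hvu, rfl, ?_⟩
  set z := vs + α • φ t with hz
  have hu := hunstable t vs hvs α vu hvu
  have hzle : ‖z‖ ≤ (1 + K₃) * ‖z + vu‖ := by
    have : ‖z‖ ≤ ‖z + vu‖ + ‖vu‖ := by simpa using norm_sub_le (z + vu) vu
    linarith
  have hn : 0 ≤ ‖z + vu‖ := norm_nonneg _
  have e1 : 0 ≤ K₁ * M := by positivity
  refine ⟨?_, ?_, ?_⟩
  · calc ‖vs‖ ≤ (1 + K₁ * M) * ((1 + K₃) * ‖z + vu‖) :=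
          (hstable t vs hvs α).trans (by gcongr)
      _ ≤ ((1 + K₁ * M + K₁) * (1 + K₃) + K₃) * ‖z + vu‖ := by
          rw [← mul_assoc]; gcongr; nlinarith [mul_nonneg hK₁ hK₃0]
  · calc |α| ≤ K₁ * ((1 + K₃) * ‖z + vu‖) := (hneutral t vs hvs α).trans (by gcongr)
      _ ≤ ((1 + K₁ * M + K₁) * (1 + K₃) + K₃) * ‖z + vu‖ := by
          rw [← mul_assoc]; gcongr; nlinarith [mul_nonneg e1 hK₃0]
  · refine hu.trans ?_
    gcongr
    have : 0 ≤ (1 + K₁ * M + K₁) * (1 + K₃) := by positivity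
    linarith

end Cocycle

section Gauge

variable {X : Type*} [NormedAddCommGroup X] [InnerProductSpace ℝ X]

/-- The support function of a set of vectors. -/
noncomputable def supportFun (B : Set X) (y : X) : ℝ := sSup ((fun v => ⟪y, v⟫) '' B)

theorem inner_le_supportFun {B : Set X} (hB : ∀ v ∈ B, ‖v‖ ≤ 1) (y : X) {v : X} (hv : v ∈ B) :
    ⟪y, v⟫ ≤ supportFun B y := by
  refine le_csSup ⟨‖y‖, ?_⟩ ⟨v, hv, rfl⟩
  rintro _ ⟨v, hv, rfl⟩
  exact (real_inner_le_norm y v).trans (mul_le_of_le_one_right (norm_nonneg _) (hB v hv))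

theorem supportFun_le {B : Set X} (h0 : (0 : X) ∈ B) {y : X} {c : ℝ} (h : ∀ v ∈ B, ⟪y, v⟫ ≤ c) :
    supportFun B y ≤ c :=
  csSup_le ⟨_, 0, h0, rfl⟩ (by rintro _ ⟨v, hv, rfl⟩; exact h v hv)

theorem supportFun_nonneg {B : Set X} (hB : ∀ v ∈ B, ‖v‖ ≤ 1) (h0 : (0 : X) ∈ B) (y : X) :
    0 ≤ supportFun B y := by
  simpa using inner_le_supportFun hB y h0

theorem supportFun_add_le {B : Set X} (hB : ∀ v ∈ B, ‖v‖ ≤ 1) (h0 : (0 : X) ∈ B) (x y : X) :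
    supportFun B (x + y) ≤ supportFun B x + ‖y‖ := by
  refine supportFun_le h0 fun v hv => ?_
  rw [inner_add_left]
  exact add_le_add (inner_le_supportFun hB x hv)
    ((real_inner_le_norm y v).trans (mul_le_of_le_one_right (norm_nonneg _) (hB v hv)))

theorem inner_le_mul_supportFun {B : Set X} (hB : ∀ v ∈ B, ‖v‖ ≤ 1) {C : ℝ} (hC : 0 < C)
    {V : Submodule ℝ X} (hV : ∀ v ∈ V, C * ‖v‖ ≤ 1 → v ∈ B) (y : X) {v : X} (hv : v ∈ V) :
    ⟪y, v⟫ ≤ C * ‖v‖ * supportFun B y := by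
  rcases eq_or_ne v 0 with rfl | hv0
  · simp
  have hn : 0 < C * ‖v‖ := mul_pos hC (norm_pos_iff.2 hv0)
  have hmem : (C * ‖v‖)⁻¹ • v ∈ B := by
    refine hV _ (V.smul_mem _ hv) ?_
    rw [norm_smul, Real.norm_eq_abs, abs_of_pos (inv_pos.2 hn), mul_left_comm,
      inv_mul_cancel₀ hn.ne']
  have h := inner_le_supportFun hB y hmem
  rw [inner_smul_right, inv_mul_le_iff₀ hn] at h
  exact h

/-- Unit ball of the adapted norm on the stable subspace. -/
def stableBall (Φ : ℝ → ℝ → X →L[ℝ] X) (Vs : ℝ → Submodule ℝ X) (μ t : ℝ) : Set X :=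
  {v | v ∈ Vs t ∧ ∀ τ, 0 ≤ τ → ‖Φ (t + τ) t v‖ ≤ Real.exp (-μ * τ)}

/-- Unit ball of the adapted norm on the unstable subspace. -/
def unstableBall (Φ : ℝ → ℝ → X →L[ℝ] X) (Vu : ℝ → Submodule ℝ X) (μ t : ℝ) : Set X :=
  {v | v ∈ Vu t ∧ ∀ τ, 0 ≤ τ → ‖Φ (t - τ) t v‖ ≤ Real.exp (-μ * τ)}

variable [CompleteSpace X]

/-- Gauges of the unstable, stable and neutral components of a covector, adapted to the adjoint
evolution `(Φ (t + h) t)†` from time `t + h` to time `t`. -/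
structure IsAdjointGauge (Φ : ℝ → ℝ → X →L[ℝ] X) (Vu : ℝ → Submodule ℝ X) (φ : ℝ → X)
    (μ K : ℝ) (Nu Ns Nn : ℝ → X → ℝ) : Prop where
  one_le : 1 ≤ K
  rate_pos : 0 < μ
  nonneg_u : ∀ t y, 0 ≤ Nu t y
  nonneg_s : ∀ t y, 0 ≤ Ns t y
  nonneg_n : ∀ t y, 0 ≤ Nn t y
  zero_u : ∀ t, Nu t 0 = 0
  zero_s : ∀ t, Ns t 0 = 0
  add_u : ∀ t x y, Nu t (x + y) ≤ Nu t x + K * ‖y‖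
  add_s : ∀ t x y, Ns t (x + y) ≤ Ns t x + K * ‖y‖
  add_n : ∀ t x y, Nn t (x + y) ≤ Nn t x + K * ‖y‖
  norm_le : ∀ t y, ‖y‖ ≤ K * (Nu t y + Ns t y + Nn t y)
  step_u : ∀ t h y, 0 ≤ h → Real.exp (μ * h) * Nu (t + h) y
    ≤ Nu t (ContinuousLinearMap.adjoint (Φ (t + h) t) y)
  step_s : ∀ t h y, 0 ≤ h → Ns t (ContinuousLinearMap.adjoint (Φ (t + h) t) y)
    ≤ Real.exp (-μ * h) * Ns (t + h) y
  step_n : ∀ t h y, Nn t (ContinuousLinearMap.adjoint (Φ (t + h) t) y) = Nn (t + h) y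
  u_eq_zero : ∀ t y, (∀ v ∈ Vu t, ⟪y, v⟫ = 0) → Nu t y = 0
  le_u : ∀ t y c, (∀ w ∈ (Vu t)ᗮ, c * ‖y‖ ≤ ‖y - w‖) → c * ‖y‖ ≤ K * Nu t y
  neutral : ∀ t y, Nn t y = |⟪y, φ t⟫|

theorem IsDichotomy.exists_gauge [FiniteDimensional ℝ X] {Φ : ℝ → ℝ → X →L[ℝ] X}
    {Vs Vu : ℝ → Submodule ℝ X} {φ : ℝ → X} {C μ M K₀ : ℝ} (D : IsDichotomy Φ Vs Vu φ C μ M)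
    (hK₀ : 0 ≤ K₀) (hs : HasBoundedSplitting Vs Vu φ K₀) :
    ∃ (K : ℝ) (Nu Ns Nn : ℝ → X → ℝ), IsAdjointGauge Φ Vu φ μ K Nu Ns Nn := by
  have hC0 : 0 < C := zero_lt_one.trans_le D.one_le
  have hM : 0 ≤ M := (norm_nonneg _).trans (D.field_le 0)
  set Bu := unstableBall Φ Vu μ with hBu
  set Bs := stableBall Φ Vs μ with hBs
  have Bu1 : ∀ t, ∀ v ∈ Bu t, ‖v‖ ≤ 1 := fun t v hv => by
    simpa [D.self] using hv.2 0 le_rfl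
  have Bs1 : ∀ t, ∀ v ∈ Bs t, ‖v‖ ≤ 1 := fun t v hv => by
    simpa [D.self] using hv.2 0 le_rfl
  have Bu0 : ∀ t, (0 : X) ∈ Bu t := fun t => ⟨zero_mem _, fun τ _ => by
    simpa using (Real.exp_pos _).le⟩
  have Bs0 : ∀ t, (0 : X) ∈ Bs t := fun t => ⟨zero_mem _, fun τ _ => by
    simpa using (Real.exp_pos _).le⟩
  have BuV : ∀ t, ∀ v ∈ Vu t, C * ‖v‖ ≤ 1 → v ∈ Bu t := fun t v hv h1 => ⟨hv, fun τ hτ => by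
    refine (D.unstable_rate t (t - τ) (by linarith) v hv).trans ?_
    rw [sub_sub_cancel, mul_right_comm]
    exact mul_le_of_le_one_left (Real.exp_pos _).le h1⟩
  have BsV : ∀ t, ∀ v ∈ Vs t, C * ‖v‖ ≤ 1 → v ∈ Bs t := fun t v hv h1 => ⟨hv, fun τ hτ => by
    refine (D.stable_rate (t + τ) t (by linarith) v hv).trans ?_
    rw [add_sub_cancel_left, mul_right_comm]
    exact mul_le_of_le_one_left (Real.exp_pos _).le h1⟩
  set K := 1 + M + C + K₀ * C + K₀ with hK
  have hKC : C ≤ K := by rw [hK]; nlinarith [mul_nonneg hK₀ hC0.le]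
  have hKM : M ≤ K := by rw [hK]; nlinarith [mul_nonneg hK₀ hC0.le]
  have hK1 : 1 ≤ K := by rw [hK]; nlinarith [mul_nonneg hK₀ hC0.le]
  have hKK : K₀ * C ≤ K := by rw [hK]; nlinarith [mul_nonneg hK₀ hC0.le]
  have hKK0 : K₀ ≤ K := by rw [hK]; nlinarith [mul_nonneg hK₀ hC0.le]
  refine ⟨K, fun t y => supportFun (Bu t) y, fun t y => supportFun (Bs t) y,
    fun t y => |⟪y, φ t⟫|, ?_⟩
  have hadd : ∀ (B : Set X), (∀ v ∈ B, ‖v‖ ≤ 1) → (0 : X) ∈ B → ∀ x y,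
      supportFun B (x + y) ≤ supportFun B x + K * ‖y‖ := fun B hB h0 x y =>
    (supportFun_add_le hB h0 x y).trans (by gcongr; exact le_mul_of_one_le_left (norm_nonneg _) hK1)
  have hzero : ∀ (B : Set X), (∀ v ∈ B, ‖v‖ ≤ 1) → (0 : X) ∈ B → supportFun B 0 = 0 :=
    fun B hB h0 => le_antisymm (supportFun_le h0 (by simp)) (supportFun_nonneg hB h0 _)
  refine
    { one_le := hK1
      rate_pos := D.rate_pos
      nonneg_u := fun t y => supportFun_nonneg (Bu1 t) (Bu0 t) y
      nonneg_s := fun t y => supportFun_nonneg (Bs1 t) (Bs0 t) y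
      nonneg_n := fun t y => abs_nonneg _
      zero_u := fun t => hzero _ (Bu1 t) (Bu0 t)
      zero_s := fun t => hzero _ (Bs1 t) (Bs0 t)
      add_u := fun t => hadd _ (Bu1 t) (Bu0 t)
      add_s := fun t => hadd _ (Bs1 t) (Bs0 t)
      add_n := ?_
      norm_le := ?_
      step_u := ?_
      step_s := ?_
      step_n := ?_
      u_eq_zero := ?_
      le_u := ?_
      neutral := fun t y => rfl }
  · intro t x y
    simp only [inner_add_left]
    refine (abs_add_le _ _).trans ?_
    gcongr
    refine (abs_real_inner_le_norm y (φ t)).trans ?_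
    rw [mul_comm]
    gcongr
    exact (D.field_le t).trans hKM
  · intro t y
    obtain ⟨vs, hvs, α, vu, hvu, he, h1, h2, h3⟩ := hs t y
    rcases eq_or_ne y 0 with rfl | hy
    · simp only [norm_zero]
      have := supportFun_nonneg (Bu1 t) (Bu0 t) (0 : X)
      have := supportFun_nonneg (Bs1 t) (Bs0 t) (0 : X)
      positivity
    have hyp : 0 < ‖y‖ := norm_pos_iff.2 hy
    have a1 := inner_le_mul_supportFun (Bs1 t) hC0 (BsV t) y hvs
    have a2 := inner_le_mul_supportFun (Bu1 t) hC0 (BuV t) y hvu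
    have n1 := supportFun_nonneg (Bu1 t) (Bu0 t) y
    have n2 := supportFun_nonneg (Bs1 t) (Bs0 t) y
    have a3 : α * ⟪y, φ t⟫ ≤ |α| * |⟪y, φ t⟫| := by
      rw [← abs_mul]; exact le_abs_self _
    have key : ‖y‖ * ‖y‖ ≤ K * (supportFun (Bu t) y + supportFun (Bs t) y + |⟪y, φ t⟫|) * ‖y‖ := by
      calc ‖y‖ * ‖y‖ = ⟪y, vs + α • φ t + vu⟫ := by
            rw [← he, real_inner_self_eq_norm_mul_norm]
        _ = ⟪y, vs⟫ + α * ⟪y, φ t⟫ + ⟪y, vu⟫ := by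
            rw [inner_add_right, inner_add_right, inner_smul_right]
        _ ≤ C * ‖vs‖ * supportFun (Bs t) y + |α| * |⟪y, φ t⟫|
            + C * ‖vu‖ * supportFun (Bu t) y := by linarith
        _ ≤ C * (K₀ * ‖y‖) * supportFun (Bs t) y + (K₀ * ‖y‖) * |⟪y, φ t⟫|
            + C * (K₀ * ‖y‖) * supportFun (Bu t) y := by gcongr
        _ = (K₀ * C) * (supportFun (Bs t) y * ‖y‖) + K₀ * (|⟪y, φ t⟫| * ‖y‖)
            + (K₀ * C) * (supportFun (Bu t) y * ‖y‖) := by ring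
        _ ≤ K * (supportFun (Bs t) y * ‖y‖) + K * (|⟪y, φ t⟫| * ‖y‖)
            + K * (supportFun (Bu t) y * ‖y‖) := by gcongr
        _ = _ := by ring
    exact le_of_mul_le_mul_right key hyp
  · intro t h y hh
    rw [mul_comm, ← le_div_iff₀ (Real.exp_pos _)]
    refine supportFun_le (Bu0 _) fun v hv => ?_
    rw [le_div_iff₀ (Real.exp_pos _)]
    have hmem : Real.exp (μ * h) • Φ t (t + h) v ∈ Bu t := by
      refine ⟨(Vu t).smul_mem _ (D.unstable_map _ _ v hv.1), fun τ hτ => ?_⟩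
      rw [map_smul, D.comp, norm_smul, Real.norm_eq_abs, abs_of_pos (Real.exp_pos _)]
      have := hv.2 (h + τ) (by linarith)
      rw [show t + h - (h + τ) = t - τ by ring] at this
      calc Real.exp (μ * h) * ‖Φ (t - τ) (t + h) v‖
          ≤ Real.exp (μ * h) * Real.exp (-μ * (h + τ)) := by gcongr
        _ = Real.exp (-μ * τ) := by rw [← Real.exp_add]; congr 1; ring
    have h1 := inner_le_supportFun (Bu1 t) (ContinuousLinearMap.adjoint (Φ (t + h) t) y) hmem
    rw [ContinuousLinearMap.adjoint_inner_left, map_smul, D.comp, D.self, inner_smul_right] at h1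
    rwa [mul_comm]
  · intro t h y hh
    refine supportFun_le (Bs0 _) fun v hv => ?_
    rw [ContinuousLinearMap.adjoint_inner_left]
    have hmem : Real.exp (μ * h) • Φ (t + h) t v ∈ Bs (t + h) := by
      refine ⟨(Vs _).smul_mem _ (D.stable_map _ _ v hv.1), fun τ hτ => ?_⟩
      rw [map_smul, D.comp, norm_smul, Real.norm_eq_abs, abs_of_pos (Real.exp_pos _)]
      have := hv.2 (h + τ) (by linarith)
      rw [← add_assoc] at this
      calc Real.exp (μ * h) * ‖Φ (t + h + τ) t v‖
          ≤ Real.exp (μ * h) * Real.exp (-μ * (h + τ)) := by gcongr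
        _ = Real.exp (-μ * τ) := by rw [← Real.exp_add]; congr 1; ring
    have h1 := inner_le_supportFun (Bs1 _) y hmem
    rw [inner_smul_right] at h1
    calc ⟪y, Φ (t + h) t v⟫ = Real.exp (-μ * h) * (Real.exp (μ * h) * ⟪y, Φ (t + h) t v⟫) := by
          rw [← mul_assoc, ← Real.exp_add]; simp
      _ ≤ _ := by gcongr
  · intro t h y
    simp only [ContinuousLinearMap.adjoint_inner_left, D.field]
  · intro t y hy
    exact le_antisymm (supportFun_le (Bu0 t) fun v hv => (hy v hv.1).le)
      (supportFun_nonneg (Bu1 t) (Bu0 t) _)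
  · intro t y c hc
    set v : X := (Vu t).starProjection y with hv
    have hvV : v ∈ Vu t := Submodule.starProjection_apply_mem _ _
    have h1 := hc (y - v) (Submodule.sub_starProjection_mem_orthogonal y)
    rw [sub_sub_cancel] at h1
    have h2 := inner_le_mul_supportFun (Bu1 t) hC0 (BuV t) y hvV
    have h3 : ⟪y, v⟫ = ‖v‖ * ‖v‖ := by
      have h4 : ⟪y - v, v⟫ = 0 := Submodule.inner_left_of_mem_orthogonal hvV
        (Submodule.sub_starProjection_mem_orthogonal y)
      rw [inner_sub_left, sub_eq_zero] at h4
      rw [h4, real_inner_self_eq_norm_mul_norm]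
    have n1 := supportFun_nonneg (Bu1 t) (Bu0 t) y
    rcases eq_or_ne v 0 with h0 | h0
    · rw [h0, norm_zero] at h1
      exact h1.trans (by positivity)
    · have hvp : 0 < ‖v‖ := norm_pos_iff.2 h0
      refine h1.trans ?_
      have : ‖v‖ * ‖v‖ ≤ C * supportFun (Bu t) y * ‖v‖ := by rw [← h3]; linarith
      exact (le_of_mul_le_mul_right this hvp).trans (by gcongr)

end Gauge

section Orbit

variable {X : Type*} [NormedAddCommGroup X] [InnerProductSpace ℝ X] {F : X → X} {Λ : Set X}
  {Es Eu : X → Submodule ℝ X} {u : ℝ → X}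

theorem IsOrbit.continuous (hu : IsOrbit F Λ u) : Continuous u :=
  continuous_iff_continuousAt.2 fun t => (hu t).2.continuousAt

theorem continuous_comp_orbit {E : Type*} [TopologicalSpace E] {G : X → E} (hu : IsOrbit F Λ u)
    (hG : ∀ x ∈ Λ, ContinuousAt G x) : Continuous fun t => G (u t) :=
  continuous_iff_continuousAt.2 fun t =>
    ContinuousAt.comp (f := u) (g := G) (hG _ (hu t).1) hu.continuous.continuousAt

theorem exists_norm_comp_orbit_le {E : Type*} [NormedAddCommGroup E] {G : X → E}
    (hΛ : IsCompact Λ) (hu : IsOrbit F Λ u) (hG : ∀ x ∈ Λ, ContinuousAt G x) :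
    ∃ B : ℝ, 0 ≤ B ∧ ∀ t, ‖G (u t)‖ ≤ B := by
  obtain ⟨B, hB⟩ := hΛ.exists_bound_of_continuousOn
    (f := G) fun x hx => (hG x hx).continuousWithinAt
  exact ⟨B, (norm_nonneg _).trans (hB _ (hu 0).1), fun t => hB _ (hu t).1⟩

theorem exists_le_norm_comp_orbit {E : Type*} [NormedAddCommGroup E] {G : X → E}
    (hΛ : IsCompact Λ) (hu : IsOrbit F Λ u) (hG : ∀ x ∈ Λ, ContinuousAt G x)
    (h0 : ∀ x ∈ Λ, G x ≠ 0) : ∃ m : ℝ, 0 < m ∧ ∀ t, m ≤ ‖G (u t)‖ := by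
  obtain ⟨x, hx, hmin⟩ := hΛ.exists_isMinOn ⟨u 0, (hu 0).1⟩
    (f := fun x => ‖G x‖) fun x hx => (hG x hx).norm.continuousWithinAt
  exact ⟨‖G x‖, norm_pos_iff.2 (h0 x hx), fun t => hmin (hu t).1⟩

theorem IsUniformlyHyperbolic.exists_splitting (hyp : IsUniformlyHyperbolic F Λ Es Eu) {x : X}
    (hx : x ∈ Λ) (v : X) : ∃ vs ∈ Es x, ∃ α : ℝ, ∃ vu ∈ Eu x, v = vs + α • F x + vu := by
  have h : (⊤ : Submodule ℝ X) ≤ Es x ⊔ Submodule.span ℝ {F x} ⊔ Eu x := by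
    rw [← (hyp.splitting x hx).submodule_iSup_eq_top]
    refine iSup_le fun i => ?_
    fin_cases i
    · exact le_sup_left.trans le_sup_left
    · exact le_sup_right.trans le_sup_left
    · exact le_sup_right
  obtain ⟨z, hz, vu, hvu, rfl⟩ := Submodule.mem_sup.1 (h (Submodule.mem_top (x := v)))
  obtain ⟨vs, hvs, w, hw, rfl⟩ := Submodule.mem_sup.1 hz
  obtain ⟨α, rfl⟩ := Submodule.mem_span_singleton.1 hw
  exact ⟨vs, hvs, α, vu, hvu, rfl⟩

theorem IsUniformlyHyperbolic.unstable_orthogonal_le [FiniteDimensional ℝ X]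
    (hyp : IsUniformlyHyperbolic F Λ Es Eu) {x : X} (hx : x ∈ Λ) :
    (Eu x)ᗮ ≤ adjCenterStable F Es Eu x := by
  have hdis : Disjoint (Es x) (Submodule.span ℝ {F x} ⊔ Eu x) := by
    refine ((hyp.splitting x hx).submodule_iSupIndep 0).mono_right (sup_le ?_ ?_)
    · exact le_iSup₂_of_le (1 : Fin 3) (by decide) le_rfl
    · exact le_iSup₂_of_le (2 : Fin 3) (by decide) le_rfl
  have hle : (Es x ⊔ Eu x) ⊓ (Submodule.span ℝ {F x} ⊔ Eu x) ≤ Eu x := by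
    rintro z ⟨h1, h2⟩
    obtain ⟨a, ha, b, hb, rfl⟩ := Submodule.mem_sup.1 h1
    have ha' : a ∈ Submodule.span ℝ {F x} ⊔ Eu x := by
      have := Submodule.sub_mem _ h2 (Submodule.mem_sup_right (S := Submodule.span ℝ {F x}) hb)
      rwa [add_sub_cancel_right] at this
    rw [Submodule.disjoint_def.1 hdis a ha ha', zero_add]
    exact hb
  have heq : adjCenterStable F Es Eu x
      = ((Es x ⊔ Eu x) ⊓ (Submodule.span ℝ {F x} ⊔ Eu x))ᗮ := by
    rw [adjCenterStable, adjNeutral, adjStable, ← Submodule.orthogonal_orthogonal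
      ((Es x ⊔ Eu x)ᗮ ⊔ (Submodule.span ℝ {F x} ⊔ Eu x)ᗮ), ← Submodule.inf_orthogonal,
      Submodule.orthogonal_orthogonal, Submodule.orthogonal_orthogonal]
  rw [heq]
  exact Submodule.orthogonal_le hle

/-- The adjoint as a real-linear continuous map. -/
noncomputable def adjointL (X : Type*) [NormedAddCommGroup X] [InnerProductSpace ℝ X]
    [CompleteSpace X] : (X →L[ℝ] X) →L[ℝ] (X →L[ℝ] X) :=
  LinearMap.mkContinuous
    { toFun := fun T => ContinuousLinearMap.adjoint T
      map_add' := fun _ _ => map_add _ _ _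
      map_smul' := fun c T => by simp } 1 fun T => by simp

theorem adjointL_apply [CompleteSpace X] (T : X →L[ℝ] X) :
    adjointL X T = ContinuousLinearMap.adjoint T := rfl

/-- The tangent flow along an orbit in a uniformly hyperbolic set has gauges adapted to its
adjoint. -/
theorem IsUniformlyHyperbolic.exists_orbit_gauge [FiniteDimensional ℝ X] [CompleteSpace X]
    (hyp : IsUniformlyHyperbolic F Λ Es Eu) (hu : IsOrbit F Λ u)
    (hF : ∀ x ∈ Λ, ContDiffAt ℝ 1 F x) :
    ∃ (Φ : ℝ → ℝ → X →L[ℝ] X) (μ K : ℝ) (Nu Ns Nn : ℝ → X → ℝ),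
      IsAdjointGauge Φ (fun t => Eu (u t)) (fun t => F (u t)) μ K Nu Ns Nn ∧
      (∀ t x, Φ t t x = x) ∧
      ∀ q y t, HasDerivAt (fun τ => ContinuousLinearMap.adjoint (Φ q τ) y)
        (-(ContinuousLinearMap.adjoint (fderiv ℝ F (u t))
          (ContinuousLinearMap.adjoint (Φ q t) y))) t := by
  have hF' : ∀ x ∈ Λ, ContinuousAt (fderiv ℝ F) x := fun x hx =>
    ((hF x hx).fderiv_right (m := 0) le_rfl).continuousAt
  have hFc : ∀ x ∈ Λ, ContinuousAt F x := fun x hx => (hF x hx).continuousAt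
  have hA := continuous_comp_orbit hu hF'
  obtain ⟨L, hL0, hL⟩ := exists_norm_comp_orbit_le hyp.compact hu hF'
  obtain ⟨M, hM0, hM⟩ := exists_norm_comp_orbit_le hyp.compact hu hFc
  obtain ⟨m, hm0, hm⟩ := exists_le_norm_comp_orbit hyp.compact hu hFc hyp.ne_zero
  obtain ⟨Z, W, hZ, hW, hZW, hWZ⟩ := exists_fundamental_solution hA hL
  obtain ⟨C, ρ, hρ0, hρ1, hrates⟩ := hyp.rates
  set Φ : ℝ → ℝ → X →L[ℝ] X := fun t r => Z t ∘L W r with hΦ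
  have hsol : ∀ r x, IsTangentSolution F u (fun t => Φ t r x) := fun r x t => by
    simpa [hΦ] using (hZ t).clm_apply (hasDerivAt_const t (W r x))
  have hself : ∀ t x, Φ t t x = x := fun t x => hZW t x
  have hWF : ∀ t, W t (F (u t)) = W 0 (F (u 0)) := fun t => by
    have hd : ∀ t, HasDerivAt (fun t => W t (F (u t))) 0 t := fun t => by
      have h1 : HasDerivAt (fun t => F (u t)) (fderiv ℝ F (u t) (F (u t))) t :=
        ((hF _ (hu t).1).differentiableAt one_ne_zero).hasFDerivAt.comp_hasDerivAt t (hu t).2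
      refine ((hW t).clm_apply h1).congr_deriv ?_
      simp
    exact is_const_of_deriv_eq_zero (fun t => (hd t).differentiableAt) (fun t => (hd t).deriv) t 0
  have hrpow : ∀ τ : ℝ, ρ ^ τ = Real.exp (-(-Real.log ρ) * τ) := fun τ => by
    rw [Real.rpow_def_of_pos hρ0, neg_neg]
  have D : IsDichotomy Φ (fun t => Es (u t)) (fun t => Eu (u t)) (fun t => F (u t)) (max C 1)
      (-Real.log ρ) M :=
    { one_le := le_max_right _ _
      rate_pos := neg_pos.2 (Real.log_neg hρ0 hρ1)
      self := hself
      comp := fun t r q x => by simp [hΦ, hWZ]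
      field := fun t r => by
        change Z t (W r (F (u r))) = F (u t)
        rw [hWF r, ← hWF t, hZW]
      field_le := hM
      stable_map := fun t r v hv =>
        hyp.stable_invariant u _ hu (hsol r v) r t (by rwa [hself])
      unstable_map := fun t r v hv =>
        hyp.unstable_invariant u _ hu (hsol r v) r t (by rwa [hself])
      stable_rate := fun t r hrt v hv => by
        have := (hrates u _ hu (hsol r v) r t hrt).1 (by rwa [hself])
        rw [hself, hrpow] at this
        refine this.trans ?_
        gcongr
        exact le_max_left _ _
      unstable_rate := fun t r hrt v hv => by
        have := (hrates u _ hu (hsol t v) r t hrt).2 (by rwa [hself])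
        rw [hself, hrpow] at this
        refine this.trans ?_
        gcongr
        exact le_max_left _ _ }
  have hgrowth : ∀ t r, r ≤ t → ∀ x, ‖Φ t r x‖ ≤ Real.exp (L * (t - r)) * ‖x‖ := by
    intro t r hrt x
    have := norm_le_gronwallBound_of_norm_deriv_right_le (f := fun t => Φ t r x)
      (f' := fun t => fderiv ℝ F (u t) (Φ t r x)) (δ := ‖x‖) (K := L) (ε := 0) (a := r) (b := t)
      (fun t _ => (hsol r x t).continuousAt.continuousWithinAt)
      (fun t _ => (hsol r x t).hasDerivWithinAt) (by simp [hself])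
      (fun t _ => by simpa using (fderiv ℝ F (u t)).le_of_opNorm_le (hL t) _) t
      (right_mem_Icc.2 hrt)
    rwa [gronwallBound_ε0, mul_comm] at this
  obtain ⟨K₀, hK₀, hsplit⟩ := D.hasBoundedSplitting hm0 hm hgrowth
    fun t v => hyp.exists_splitting (hu t).1 v
  obtain ⟨K, Nu, Ns, Nn, hG⟩ := D.exists_gauge hK₀ hsplit
  refine ⟨Φ, _, K, Nu, Ns, Nn, hG, hself, fun q y t => ?_⟩
  have h1 : HasDerivAt (fun τ => adjointL X (Φ q τ))
      (adjointL X (Z q ∘L (-(W t ∘L fderiv ℝ F (u t))))) t := by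
    refine (adjointL X).hasFDerivAt.comp_hasDerivAt t ?_
    exact (((ContinuousLinearMap.compL ℝ X X X) (Z q)).hasFDerivAt).comp_hasDerivAt t (hW t)
  have h2 := h1.clm_apply (hasDerivAt_const t y)
  simp only [adjointL_apply, map_zero, add_zero] at h2
  refine h2.congr_deriv (ext_inner_right ℝ fun z => ?_)
  rw [ContinuousLinearMap.adjoint_inner_left, inner_neg_left,
    ContinuousLinearMap.adjoint_inner_left, ContinuousLinearMap.adjoint_inner_left]
  simp [hΦ]

end Orbit

section BddDeriv

variable {E F : Type*} [NormedAddCommGroup E] [NormedSpace ℝ E] [NormedAddCommGroup F]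
  [NormedSpace ℝ F]

/-- `G` is `n` times continuously differentiable on `[0, ∞)` with bounded derivatives. -/
def BddDeriv {E : Type*} [NormedAddCommGroup E] [NormedSpace ℝ E] : ℕ → (ℝ → E) → Prop
  | 0, G => ContinuousOn G (Ici 0) ∧ ∃ B : ℝ, ∀ t, 0 ≤ t → ‖G t‖ ≤ B
  | n + 1, G => (∃ B : ℝ, ∀ t, 0 ≤ t → ‖G t‖ ≤ B) ∧
      ∃ G' : ℝ → E, (∀ t ∈ Ici (0 : ℝ), HasDerivWithinAt G (G' t) (Ici 0) t) ∧ BddDeriv n G'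

theorem BddDeriv.bdd {n : ℕ} {G : ℝ → E} (h : BddDeriv n G) :
    ∃ B : ℝ, ∀ t, 0 ≤ t → ‖G t‖ ≤ B := by
  cases n with
  | zero => exact h.2
  | succ n => exact h.1

theorem BddDeriv.continuousOn {n : ℕ} {G : ℝ → E} (h : BddDeriv n G) :
    ContinuousOn G (Ici 0) := by
  cases n with
  | zero => exact h.1
  | succ n =>
    obtain ⟨-, G', hG', -⟩ := h
    exact fun t ht => (hG' t ht).continuousWithinAt

theorem BddDeriv.of_succ {n : ℕ} {G : ℝ → E} (h : BddDeriv (n + 1) G) : BddDeriv n G := by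
  induction n generalizing G with
  | zero => exact ⟨h.continuousOn, h.bdd⟩
  | succ n ih =>
    obtain ⟨hB, G', hG', h'⟩ := h
    exact ⟨hB, G', hG', ih h'⟩

theorem BddDeriv.add {n : ℕ} {G H : ℝ → E} (hG : BddDeriv n G) (hH : BddDeriv n H) :
    BddDeriv n fun t => G t + H t := by
  have hb : ∃ B : ℝ, ∀ t, 0 ≤ t → ‖G t + H t‖ ≤ B := by
    obtain ⟨B, hB⟩ := hG.bdd
    obtain ⟨B', hB'⟩ := hH.bdd
    exact ⟨B + B', fun t ht => (norm_add_le _ _).trans (add_le_add (hB t ht) (hB' t ht))⟩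
  induction n generalizing G H with
  | zero => exact ⟨hG.continuousOn.add hH.continuousOn, hb⟩
  | succ n ih =>
    obtain ⟨-, G', hG', h1⟩ := hG
    obtain ⟨-, H', hH', h2⟩ := hH
    refine ⟨hb, _, fun t ht => (hG' t ht).add (hH' t ht), ih h1 h2 ?_⟩
    obtain ⟨B, hB⟩ := h1.bdd
    obtain ⟨B', hB'⟩ := h2.bdd
    exact ⟨B + B', fun t ht => (norm_add_le _ _).trans (add_le_add (hB t ht) (hB' t ht))⟩

theorem BddDeriv.clm {n : ℕ} {G : ℝ → E} (hG : BddDeriv n G) (T : E →L[ℝ] F) :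
    BddDeriv n fun t => T (G t) := by
  have hb : ∀ {G : ℝ → E}, (∃ B : ℝ, ∀ t, 0 ≤ t → ‖G t‖ ≤ B) →
      ∃ B : ℝ, ∀ t, 0 ≤ t → ‖T (G t)‖ ≤ B := by
    rintro G ⟨B, hB⟩
    exact ⟨‖T‖ * B, fun t ht => T.le_opNorm_of_le (hB t ht)⟩
  induction n generalizing G with
  | zero => exact ⟨T.continuous.comp_continuousOn hG.continuousOn, hb hG.bdd⟩
  | succ n ih =>
    obtain ⟨hB, G', hG', h1⟩ := hG
    exact ⟨hb hB, _, fun t ht => T.hasFDerivAt.comp_hasDerivWithinAt t (hG' t ht), ih h1⟩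

theorem BddDeriv.clm_apply {n : ℕ} {A : ℝ → E →L[ℝ] F} {G : ℝ → E} (hA : BddDeriv n A)
    (hG : BddDeriv n G) : BddDeriv n fun t => A t (G t) := by
  have hb : ∃ B : ℝ, ∀ t, 0 ≤ t → ‖A t (G t)‖ ≤ B := by
    obtain ⟨B, hB⟩ := hA.bdd
    obtain ⟨B', hB'⟩ := hG.bdd
    exact ⟨B * B', fun t ht => (A t).le_of_opNorm_le_of_le (hB t ht) (hB' t ht)⟩
  induction n generalizing A G with
  | zero => exact ⟨hA.continuousOn.clm_apply hG.continuousOn, hb⟩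
  | succ n ih =>
    have hA0 := hA.of_succ
    have hG0 := hG.of_succ
    obtain ⟨-, A', hA', h1⟩ := hA
    obtain ⟨-, G', hG', h2⟩ := hG
    refine ⟨hb, _, fun t ht => (hA' t ht).clm_apply (hG' t ht), (ih h1 hG0 ?_).add (ih hA0 h2 ?_)⟩
    · obtain ⟨B, hB⟩ := h1.bdd
      obtain ⟨B', hB'⟩ := hG0.bdd
      exact ⟨B * B', fun t ht => (A' t).le_of_opNorm_le_of_le (hB t ht) (hB' t ht)⟩
    · obtain ⟨B, hB⟩ := hA0.bdd
      obtain ⟨B', hB'⟩ := h2.bdd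
      exact ⟨B * B', fun t ht => (A t).le_of_opNorm_le_of_le (hB t ht) (hB' t ht)⟩

theorem BddDeriv.contDiffOn_Icc {n : ℕ} {G : ℝ → E} (hG : BddDeriv n G) :
    ∃ B : ℝ, 0 ≤ B ∧ ∀ T : ℝ, 0 < T → ContDiffOn ℝ n G (Icc 0 T) ∧
      ∀ j ≤ n, ∀ t ∈ Icc 0 T, ‖iteratedDerivWithin j G (Icc 0 T) t‖ ≤ B := by
  induction n generalizing G with
  | zero =>
    obtain ⟨hc, B, hB⟩ := hG
    refine ⟨B, (norm_nonneg _).trans (hB 0 le_rfl), fun T hT => ⟨?_, fun j hj t ht => ?_⟩⟩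
    · exact contDiffOn_zero.2 (hc.mono Icc_subset_Ici_self)
    · obtain rfl := Nat.le_zero.1 hj
      simpa using hB t ht.1
  | succ n ih =>
    obtain ⟨⟨B, hB⟩, G', hG', h1⟩ := hG
    obtain ⟨B', hB'0, hB'⟩ := ih h1
    refine ⟨max B B', hB'0.trans (le_max_right _ _), fun T hT => ?_⟩
    obtain ⟨hc, hb⟩ := hB' T hT
    have hU := uniqueDiffOn_Icc hT
    have hd : ∀ t ∈ Icc 0 T, HasDerivWithinAt G (G' t) (Icc 0 T) t := fun t ht =>
      (hG' t ht.1).mono Icc_subset_Ici_self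
    have he : EqOn (derivWithin G (Icc 0 T)) G' (Icc 0 T) := fun t ht =>
      (hd t ht).derivWithin (hU t ht)
    refine ⟨?_, fun j hj t ht => ?_⟩
    · rw [Nat.cast_add, Nat.cast_one, contDiffOn_succ_iff_derivWithin hU]
      exact ⟨fun t ht => (hd t ht).differentiableWithinAt, by simp, hc.congr he⟩
    · cases j with
      | zero => simpa using Or.inl (hB t ht.1)
      | succ j =>
        rw [iteratedDerivWithin_succ', iteratedDerivWithin_congr he ht]
        exact (hb j (by omega) t ht).trans (le_max_right _ _)

theorem bddDeriv_comp_orbit {X : Type*} [NormedAddCommGroup X] [InnerProductSpace ℝ X]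
    {F₀ : X → X} {Λ : Set X} {u : ℝ → X} (hΛ : IsCompact Λ) (hu : IsOrbit F₀ Λ u) {n : ℕ}
    (hF : ∀ x ∈ Λ, ContDiffAt ℝ n F₀ x) {G : X → E} (hG : ∀ x ∈ Λ, ContDiffAt ℝ n G x) :
    BddDeriv n fun t => G (u t) := by
  have hb : ∀ {G : X → E}, (∀ x ∈ Λ, ContinuousAt G x) →
      ∃ B : ℝ, ∀ t, 0 ≤ t → ‖G (u t)‖ ≤ B := fun hG => by
    obtain ⟨B, -, hB⟩ := exists_norm_comp_orbit_le hΛ hu hG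
    exact ⟨B, fun t _ => hB t⟩
  induction n generalizing G with
  | zero =>
    have hc : ∀ x ∈ Λ, ContinuousAt G x := fun x hx => (hG x hx).continuousAt
    exact ⟨(continuous_comp_orbit hu hc).continuousOn, hb hc⟩
  | succ n ih =>
    refine ⟨hb fun x hx => (hG x hx).continuousAt, fun t => fderiv ℝ G (u t) (F₀ (u t)),
      fun t _ => ?_, ?_⟩
    · exact (((hG _ (hu t).1).differentiableAt (by simp)).hasFDerivAt.comp_hasDerivAt t
        (hu t).2).hasDerivWithinAt
    · have hF' : ∀ x ∈ Λ, ContDiffAt ℝ n F₀ x := fun x hx => (hF x hx).of_le (by simp)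
      exact ih (G := fun x => fderiv ℝ G x (F₀ x)) hF' fun x hx =>
        ((hG x hx).fderiv_right (m := n) (by simp)).clm_apply (hF' x hx)

end BddDeriv

theorem contDiffAt_slice {X E : Type*} [NormedAddCommGroup X] [NormedSpace ℝ X]
    [NormedAddCommGroup E] [NormedSpace ℝ E] {G : X → ℝ → E} {s : ℝ}
    {n : WithTop ℕ∞} {x : X} (hG : ContDiffAt ℝ n (fun p : X × ℝ => G p.1 p.2) (x, s)) :
    ContDiffAt ℝ n (fun x => G x s) x :=
  ContDiffAt.comp (f := fun x => (x, s)) (g := fun p : X × ℝ => G p.1 p.2) x hG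
    (contDiffAt_id.prodMk contDiffAt_const)

theorem contDiffAt_deriv_param {X E : Type*} [NormedAddCommGroup X] [NormedSpace ℝ X]
    [NormedAddCommGroup E] [NormedSpace ℝ E] {G : X → ℝ → E} {s : ℝ} {n : ℕ} {x : X}
    (hG : ContDiffAt ℝ (n + 1 : ℕ) (fun p : X × ℝ => G p.1 p.2) (x, s)) :
    ContDiffAt ℝ n (fun x => deriv (fun σ => G x σ) s) x := by
  set H : X → E := fun x => fderiv ℝ (fun p : X × ℝ => G p.1 p.2) (x, s) (0, 1) with hH
  have h1 : ContDiffAt ℝ n H x := by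
    have : ContDiffAt ℝ n (fun x => fderiv ℝ (fun p : X × ℝ => G p.1 p.2) (x, s)) x :=
      ContDiffAt.comp (f := fun x => (x, s)) (g := fderiv ℝ (fun p : X × ℝ => G p.1 p.2)) x
        (hG.fderiv_right (m := n) (by simp)) (contDiffAt_id.prodMk contDiffAt_const)
    exact this.clm_apply contDiffAt_const
  refine h1.congr_of_eventuallyEq ?_
  have h2 : ∀ᶠ p in 𝓝 (x, s), DifferentiableAt ℝ (fun p : X × ℝ => G p.1 p.2) p := by
    refine ((hG.of_le (m := 1) (by simp)).eventually (by simp)).mono fun p hp => ?_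
    exact hp.differentiableAt one_ne_zero
  have h3 : Tendsto (fun x : X => (x, s)) (𝓝 x) (𝓝 (x, s)) :=
    (continuous_id.prodMk continuous_const).tendsto x
  filter_upwards [h3.eventually h2] with z hz
  have h4 : HasDerivAt (fun σ => (z, σ)) ((0 : X), (1 : ℝ)) s :=
    (hasDerivAt_const s z).prodMk (hasDerivAt_id s)
  exact (HasFDerivAt.comp_hasDerivAt (l := fun p : X × ℝ => G p.1 p.2) s hz.hasFDerivAt h4).deriv

section Quadrature

theorem IsQuadrature.abs_error_le {Cq : ℝ} {k : ℕ} {T : ℝ} {N : ℕ} {w : ℕ → ℝ}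
    (hw : IsQuadrature Cq k T N w) (hT : 0 < T) {F : ℝ → ℝ} {B : ℝ}
    (hF : ContDiffOn ℝ k F (Icc 0 T))
    (hB : ∀ j ≤ k, ∀ t ∈ Icc 0 T, |iteratedDerivWithin j F (Icc 0 T) t| ≤ B) :
    |(∑ p ∈ Finset.range (N + 1), w p * F (p * (T / N))) - ∫ t in (0 : ℝ)..T, F t|
      ≤ |Cq| * T * B * (T / N) ^ k := by
  have hB0 : 0 ≤ B := (abs_nonneg _).trans (hB 0 (Nat.zero_le _) 0 (left_mem_Icc.2 hT.le))
  refine (hw.error F B hF hB).trans ?_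
  gcongr
  exact le_abs_self _

theorem IsQuadrature.sum_exp_le {Cq : ℝ} {k : ℕ} {T : ℝ} {N : ℕ} {w : ℕ → ℝ}
    (hw : IsQuadrature Cq k T N w) (hT : 0 < T) (b d : ℝ)
    (hbd : ∀ t ∈ Icc 0 T, d + b * t ≤ 0) :
    ∑ p ∈ Finset.range (N + 1), w p * Real.exp (d + b * (p * (T / N)))
      ≤ (∫ t in (0 : ℝ)..T, Real.exp (d + b * t))
        + |Cq| * T * (max 1 |b|) ^ k * (T / N) ^ k := by
  have hsm : ContDiff ℝ k fun t : ℝ => Real.exp (d + b * t) := by fun_prop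
  have h := hw.abs_error_le hT (F := fun t => Real.exp (d + b * t)) (B := (max 1 |b|) ^ k)
    hsm.contDiffOn fun j hj t ht => by
      rw [iteratedDerivWithin_eq_iteratedDeriv (uniqueDiffOn_Icc hT)
        (hsm.contDiffAt.of_le (by exact_mod_cast hj)) ht]
      have he : (fun t : ℝ => Real.exp (d + b * t))
          = fun t => Real.exp d * (fun t => Real.exp (b * t)) t := by
        ext t; rw [Real.exp_add]
      rw [he, iteratedDeriv_const_mul_field, iteratedDeriv_exp_const_mul]
      have e2 : Real.exp d * (b ^ j * Real.exp (b * t)) = b ^ j * Real.exp (d + b * t) := by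
        rw [Real.exp_add]; ring
      rw [e2, abs_mul, abs_pow, Real.abs_exp]
      calc |b| ^ j * Real.exp (d + b * t) ≤ |b| ^ j * 1 := by
            gcongr; exact Real.exp_le_one_iff.2 (hbd t ht)
        _ ≤ (max 1 |b|) ^ j := by rw [mul_one]; gcongr; exact le_max_right _ _
        _ ≤ (max 1 |b|) ^ k := pow_le_pow_right₀ (le_max_left _ _) hj
  have := (abs_le.1 h).2
  linarith

theorem integral_exp_affine_le {b : ℝ} (hb : b ≠ 0) {d T : ℝ} (h0 : d ≤ 0)
    (h1 : d + b * T ≤ 0) : ∫ t in (0 : ℝ)..T, Real.exp (d + b * t) ≤ 1 / |b| := by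
  have hd : ∀ t ∈ uIcc 0 T, HasDerivAt (fun t => Real.exp (d + b * t) / b)
      (Real.exp (d + b * t)) t := fun t _ => by
    have : HasDerivAt (fun t : ℝ => d + b * t) b t := by
      simpa using ((hasDerivAt_id t).const_mul b).const_add d
    refine (this.exp.div_const b).congr_deriv (by field_simp)
  rw [intervalIntegral.integral_eq_sub_of_hasDerivAt hd
    (Continuous.intervalIntegrable (by fun_prop) _ _)]
  have e0 : Real.exp (d + b * 0) ≤ 1 := Real.exp_le_one_iff.2 (by linarith)
  have e1 : Real.exp (d + b * T) ≤ 1 := Real.exp_le_one_iff.2 h1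
  have p0 := Real.exp_pos (d + b * 0)
  have p1 := Real.exp_pos (d + b * T)
  rw [← sub_div]
  refine (le_abs_self _).trans ?_
  rw [abs_div]
  gcongr
  exact abs_le.2 ⟨by linarith, by linarith⟩

end Quadrature

section Shadowing

variable {X : Type*} [NormedAddCommGroup X] [InnerProductSpace ℝ X] [CompleteSpace X]
  {f : X → ℝ → X} {J : X → ℝ → ℝ} {s : ℝ} {Λ : Set X} {Es Eu : X → Submodule ℝ X} {u ψ : ℝ → X}

/-- The Riesz isomorphism as a real-linear continuous map. -/
noncomputable def rieszL (X : Type*) [NormedAddCommGroup X] [InnerProductSpace ℝ X]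
    [CompleteSpace X] : (X →L[ℝ] ℝ) →L[ℝ] X :=
  LinearMap.mkContinuous
    { toFun := fun l => (InnerProductSpace.toDual ℝ X).symm l
      map_add' := fun _ _ => map_add _ _ _
      map_smul' := fun c l => by simp } 1 fun l => by simp

/-- The inner product as a real-linear continuous map. -/
noncomputable def innerL (X : Type*) [NormedAddCommGroup X] [InnerProductSpace ℝ X] :
    X →L[ℝ] (X →L[ℝ] ℝ) :=
  LinearMap.mkContinuous
    { toFun := fun x => innerSL ℝ x
      map_add' := fun _ _ => map_add _ _ _
      map_smul' := fun c l => by simp } 1 fun l => by simp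

theorem IsAdjointShadowing.bddDeriv (hψ : IsAdjointShadowing f J s Es Eu u ψ) (hΛ : IsCompact Λ)
    (hu : IsOrbit (fun x => f x s) Λ u) {k : ℕ}
    (hf : ∀ x ∈ Λ, ContDiffAt ℝ (k + 1 : ℕ) (fun x => f x s) x)
    (hJ : ∀ x ∈ Λ, ContDiffAt ℝ (k + 1 : ℕ) (fun x => J x s) x) : BddDeriv k ψ := by
  have hf' : ∀ x ∈ Λ, ContDiffAt ℝ k (fun x => f x s) x := fun x hx => (hf x hx).of_le (by simp)
  have hA := (bddDeriv_comp_orbit hΛ hu hf' fun x hx =>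
    ((hf x hx).fderiv_right (m := k) (by simp))).clm (adjointL X)
  have hg := (bddDeriv_comp_orbit hΛ hu hf' fun x hx =>
    ((hJ x hx).fderiv_right (m := k) (by simp))).clm (rieszL X)
  have hc : ContinuousOn ψ (Ici 0) := fun t ht => (hψ.adjoint_eq t ht).continuousWithinAt
  clear hf hJ hf'
  induction k with
  | zero => exact ⟨hc, hψ.bounded⟩
  | succ k ih =>
    have h := ih hA.of_succ hg.of_succ
    refine ⟨hψ.bounded, _, hψ.adjoint_eq, ?_⟩
    have h1 := ((hA.of_succ.clm_apply h).add hg.of_succ).clm (-(ContinuousLinearMap.id ℝ X))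
    refine cast (congrArg _ ?_) h1
    ext t
    change -(ContinuousLinearMap.adjoint (fderiv ℝ (fun x => f x s) (u t)) (ψ t)
      + gradient (fun x => J x s) (u t)) = _
    abel

/-- The neutral component of the adjoint shadowing direction. -/
theorem IsAdjointShadowing.inner_eq (hψ : IsAdjointShadowing f J s Es Eu u ψ)
    (hu : IsOrbit (fun x => f x s) Λ u)
    (hf : ∀ x ∈ Λ, DifferentiableAt ℝ (fun x => f x s) x)
    (hJ : ∀ x ∈ Λ, DifferentiableAt ℝ (fun x => J x s) x) {Jbar : ℝ}
    (hJbar : Tendsto (fun T : ℝ => (1 / T) * ∫ t in (0 : ℝ)..T, J (u t) s) atTop (𝓝 Jbar))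
    {t : ℝ} (ht : 0 ≤ t) : ⟪ψ t, f (u t) s⟫ = Jbar - J (u t) s := by
  have hfd : ∀ t, HasDerivAt (fun t => f (u t) s)
      (fderiv ℝ (fun x => f x s) (u t) (f (u t) s)) t := fun t =>
    (hf _ (hu t).1).hasFDerivAt.comp_hasDerivAt (f := u) t (hu t).2
  have hJd : ∀ t, HasDerivAt (fun t => J (u t) s)
      (fderiv ℝ (fun x => J x s) (u t) (f (u t) s)) t := fun t =>
    (hJ _ (hu t).1).hasFDerivAt.comp_hasDerivAt (f := u) t (hu t).2
  set H : ℝ → ℝ := fun t => ⟪ψ t, f (u t) s⟫ + J (u t) s with hH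
  have hHd : ∀ t ∈ Ici (0 : ℝ), HasDerivWithinAt H 0 (Ici 0) t := fun t ht => by
    refine (((hψ.adjoint_eq t ht).inner ℝ (hfd t).hasDerivWithinAt).add
      (hJd t).hasDerivWithinAt).congr_deriv ?_
    have hg : ⟪gradient (fun x => J x s) (u t), f (u t) s⟫
        = fderiv ℝ (fun x => J x s) (u t) (f (u t) s) :=
      InnerProductSpace.toDual_symm_apply
    rw [inner_sub_left, inner_neg_left, ContinuousLinearMap.adjoint_inner_left, hg]
    ring
  have hconst : ∀ t, 0 ≤ t → H t = H 0 := fun t ht =>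
    constant_of_has_deriv_right_zero (a := 0) (b := t)
      (fun x hx => ((hHd x hx.1).continuousWithinAt).mono Icc_subset_Ici_self)
      (fun x hx => (hHd x hx.1).mono (Ici_subset_Ici.2 hx.1)) t (right_mem_Icc.2 ht)
  have hlim := hψ.neutral_mean.add hJbar
  have hev : (fun T : ℝ => (1 / T) * (∫ t in (0 : ℝ)..T, ⟪ψ t, f (u t) s⟫)
      + (1 / T) * ∫ t in (0 : ℝ)..T, J (u t) s) =ᶠ[atTop] fun _ => H 0 := by
    filter_upwards [eventually_gt_atTop 0] with T hT
    have hsub : uIcc 0 T ⊆ Ici (0 : ℝ) := by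
      rw [uIcc_of_le hT.le]; exact Icc_subset_Ici_self
    have c1 : ContinuousOn (fun t => ⟪ψ t, f (u t) s⟫) (uIcc 0 T) := fun t ht =>
      (((hψ.adjoint_eq t (hsub ht)).continuousWithinAt).inner
        (hfd t).continuousAt.continuousWithinAt).mono hsub
    have c2 : ContinuousOn (fun t => J (u t) s) (uIcc 0 T) := fun t _ =>
      (hJd t).continuousAt.continuousWithinAt
    rw [← mul_add, ← intervalIntegral.integral_add c1.intervalIntegrable c2.intervalIntegrable]
    have : ∫ t in (0 : ℝ)..T, (⟪ψ t, f (u t) s⟫ + J (u t) s) = ∫ _ in (0 : ℝ)..T, H 0 :=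
      intervalIntegral.integral_congr fun t ht => hconst t (hsub ht)
    rw [this]
    simp
    field_simp
  have h0 : H 0 = 0 + Jbar := tendsto_nhds_unique (tendsto_const_nhds.congr' hev.symm) hlim
  have := hconst t ht
  rw [h0] at this
  simp only [hH] at this
  linarith

end Shadowing

section Scheme

variable {X : Type*} [NormedAddCommGroup X] [InnerProductSpace ℝ X] [CompleteSpace X]
  {f : X → ℝ → X} {J : X → ℝ → ℝ} {s : ℝ} {u ψ : ℝ → X}

theorem le_of_forall_mul_le_add {a b d : ℝ} (h : ∀ l : ℝ, 0 < l → l * a ≤ l * b + d) : a ≤ b := by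
  by_contra hab
  push Not at hab
  have hpos : 0 < a - b := by linarith
  have := h ((|d| + 1) / (a - b)) (by positivity)
  have e : (|d| + 1) / (a - b) * (a - b) = |d| + 1 := by field_simp
  nlinarith [le_abs_self d]

/-- A scheme of order `k` has local error `O(h ^ (k + 1))` both for the homogeneous equation and
along a bounded solution of the inhomogeneous one. -/
theorem AdjointScheme.HasOrder.exists_step {S : AdjointScheme X} {k : ℕ}
    (hS : S.HasOrder k f J s u) (hψ : IsAdjointSolutionOn f J s u (Ici 0) ψ)
    (hb : ∃ B : ℝ, ∀ t : ℝ, 0 ≤ t → ‖ψ t‖ ≤ B) {Φ : ℝ → ℝ → X →L[ℝ] X}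
    (hself : ∀ t x, Φ t t x = x)
    (hΦ : ∀ q y t, HasDerivAt (fun τ => ContinuousLinearMap.adjoint (Φ q τ) y)
        (-(ContinuousLinearMap.adjoint (fderiv ℝ (fun x => f x s) (u t))
          (ContinuousLinearMap.adjoint (Φ q t) y))) t) :
    ∃ C : ℝ, 0 ≤ C ∧ ∃ h₀ : ℝ, 0 < h₀ ∧ ∀ h : ℝ, 0 < h → h < h₀ → ∀ t : ℝ, 0 ≤ t →
      (∀ y, ‖S.A h t y - ContinuousLinearMap.adjoint (Φ (t + h) t) y‖
        ≤ C * h ^ (k + 1) * ‖y‖) ∧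
      ‖S.A h t (ψ (t + h)) + S.g h t - ψ t‖ ≤ C * h ^ (k + 1) := by
  obtain ⟨C₀, h₀, hh₀, hord⟩ := hS
  obtain ⟨B, hB⟩ := hb
  have hB0 : 0 ≤ B := (norm_nonneg _).trans (hB 0 le_rfl)
  set C := |C₀| with hC
  have hC0 : 0 ≤ C := abs_nonneg _
  have hord' : ∀ h : ℝ, 0 < h → h < h₀ → ∀ t : ℝ, 0 ≤ t → ∀ ψ : ℝ → X,
      IsAdjointSolutionOn f J s u (Icc t (t + h)) ψ →
      ‖S.A h t (ψ (t + h)) + S.g h t - ψ t‖ ≤ C * (1 + ‖ψ (t + h)‖) * h ^ (k + 1) := by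
    intro h hh hhh t ht ψ hψ
    refine (hord h hh hhh t ht ψ hψ).trans ?_
    gcongr
    exact le_abs_self _
  refine ⟨C * (1 + B), by positivity, h₀, hh₀, fun h hh hhh t ht => ?_⟩
  have hsub : Icc t (t + h) ⊆ Ici (0 : ℝ) := fun x hx => ht.trans hx.1
  refine ⟨fun y => ?_, ?_⟩
  · have hid : ∀ z, ContinuousLinearMap.adjoint (Φ (t + h) (t + h)) z = z := fun z =>
      ext_inner_right ℝ fun x => by rw [ContinuousLinearMap.adjoint_inner_left, hself]
    have hH : 0 < h ^ (k + 1) := by positivity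
    have hsol : ∀ l : ℝ, IsAdjointSolutionOn f J s u (Icc t (t + h))
        (fun τ => ψ τ + l • ContinuousLinearMap.adjoint (Φ (t + h) τ) y) := by
      intro l τ hτ
      have h1 := (hψ τ (ht.trans hτ.1)).mono hsub
      have h2 := ((hΦ (t + h) y τ).const_smul l).hasDerivWithinAt (s := Icc t (t + h))
      refine (h1.add h2).congr_deriv ?_
      rw [map_add, map_smul, smul_neg]
      abel
    have key : ‖S.A h t y - ContinuousLinearMap.adjoint (Φ (t + h) t) y‖
        ≤ C * h ^ (k + 1) * ‖y‖ := by
      refine le_of_forall_mul_le_add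
        (d := C * (1 + B) * h ^ (k + 1) + ‖S.A h t (ψ (t + h)) + S.g h t - ψ t‖) fun l hl => ?_
      have h1 := hord' h hh hhh t ht _ (hsol l)
      simp only [hid] at h1
      have e : l • (S.A h t y - ContinuousLinearMap.adjoint (Φ (t + h) t) y)
          = (S.A h t (ψ (t + h) + l • y) + S.g h t
            - (ψ t + l • ContinuousLinearMap.adjoint (Φ (t + h) t) y))
            - (S.A h t (ψ (t + h)) + S.g h t - ψ t) := by
        rw [map_add, map_smul, smul_sub]; abel
      have h2 : ‖ψ (t + h) + l • y‖ ≤ B + l * ‖y‖ := by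
        refine (norm_add_le _ _).trans ?_
        rw [norm_smul, Real.norm_eq_abs, abs_of_pos hl]
        gcongr
        exact hB _ (by linarith)
      calc l * ‖S.A h t y - ContinuousLinearMap.adjoint (Φ (t + h) t) y‖
          = ‖l • (S.A h t y - ContinuousLinearMap.adjoint (Φ (t + h) t) y)‖ := by
            rw [norm_smul, Real.norm_eq_abs, abs_of_pos hl]
        _ ≤ C * (1 + (B + l * ‖y‖)) * h ^ (k + 1)
            + ‖S.A h t (ψ (t + h)) + S.g h t - ψ t‖ := by
            rw [e]
            refine (norm_sub_le _ _).trans ?_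
            gcongr
            exact h1.trans (by gcongr)
        _ = _ := by ring
    refine key.trans ?_
    gcongr
    exact le_mul_of_one_le_right hC0 (by linarith)
  · have h1 := hord' h hh hhh t ht ψ fun τ hτ =>
      (hψ τ (ht.trans hτ.1)).mono hsub
    refine h1.trans ?_
    gcongr
    exact hB _ (by linarith)

end Scheme

section Discrete

variable {X : Type*} [NormedAddCommGroup X] [NormedSpace ℝ X]

/-- Gauges adapted to a perturbed backward step `B p` from grid point `p + 1` to grid point `p`. -/
structure IsGridGauge (B : ℕ → X →L[ℝ] X) (nu ns nn : ℕ → X → ℝ) (μ h δ K : ℝ) : Prop where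
  one_le : 1 ≤ K
  rate_pos : 0 < μ
  h_pos : 0 < h
  nonneg_u : ∀ p y, 0 ≤ nu p y
  nonneg_s : ∀ p y, 0 ≤ ns p y
  nonneg_n : ∀ p y, 0 ≤ nn p y
  add_u : ∀ p x y, nu p (x + y) ≤ nu p x + K * ‖y‖
  add_s : ∀ p x y, ns p (x + y) ≤ ns p x + K * ‖y‖
  add_n : ∀ p x y, nn p (x + y) ≤ nn p x + K * ‖y‖
  norm_le : ∀ p y, ‖y‖ ≤ K * (nu p y + ns p y + nn p y)
  step_u : ∀ p y, Real.exp (μ * h) * nu (p + 1) y ≤ nu p (B p y) + δ * ‖y‖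
  step_s : ∀ p y, ns p (B p y) ≤ Real.exp (-μ * h) * ns (p + 1) y + δ * ‖y‖
  step_n : ∀ p y, nn p (B p y) ≤ nn (p + 1) y + δ * ‖y‖

theorem IsAdjointGauge.isGridGauge {X : Type*} [NormedAddCommGroup X] [InnerProductSpace ℝ X]
    [CompleteSpace X] {Φ : ℝ → ℝ → X →L[ℝ] X} {Vu : ℝ → Submodule ℝ X} {φ : ℝ → X}
    {μ K : ℝ} {Nu Ns Nn : ℝ → X → ℝ} (hG : IsAdjointGauge Φ Vu φ μ K Nu Ns Nn)
    {A : ℝ → X →L[ℝ] X} {h ε : ℝ} (hh : 0 < h)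
    (hA : ∀ t, 0 ≤ t → ∀ y, ‖A t y - ContinuousLinearMap.adjoint (Φ (t + h) t) y‖ ≤ ε * ‖y‖) :
    IsGridGauge (fun p : ℕ => A (p * h)) (fun p y => Nu (p * h) y) (fun p y => Ns (p * h) y)
      (fun p y => Nn (p * h) y) μ h (K * ε) K := by
  have hK0 : 0 ≤ K := zero_le_one.trans hG.one_le
  have ht : ∀ p : ℕ, ((p + 1 : ℕ) : ℝ) * h = p * h + h := fun p => by push_cast; ring
  have e1 : ∀ p : ℕ, ∀ y, A (p * h) y = ContinuousLinearMap.adjoint (Φ (p * h + h) (p * h)) y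
      + (A (p * h) y - ContinuousLinearMap.adjoint (Φ (p * h + h) (p * h)) y) := fun p y => by abel
  have e2 : ∀ p : ℕ, ∀ y, ContinuousLinearMap.adjoint (Φ (p * h + h) (p * h)) y = A (p * h) y
      + -(A (p * h) y - ContinuousLinearMap.adjoint (Φ (p * h + h) (p * h)) y) :=
    fun p y => by abel
  have hd : ∀ p : ℕ, ∀ y,
      K * ‖A (p * h) y - ContinuousLinearMap.adjoint (Φ (p * h + h) (p * h)) y‖
        ≤ K * ε * ‖y‖ := fun p y => by
    rw [mul_assoc]
    exact mul_le_mul_of_nonneg_left (hA _ (by positivity) y) hK0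
  refine
    { one_le := hG.one_le
      rate_pos := hG.rate_pos
      h_pos := hh
      nonneg_u := fun p => hG.nonneg_u _
      nonneg_s := fun p => hG.nonneg_s _
      nonneg_n := fun p => hG.nonneg_n _
      add_u := fun p => hG.add_u _
      add_s := fun p => hG.add_s _
      add_n := fun p => hG.add_n _
      norm_le := fun p => hG.norm_le _
      step_u := fun p y => ?_
      step_s := fun p y => ?_
      step_n := fun p y => ?_ }
  · rw [ht]
    refine (hG.step_u (p * h) h y hh.le).trans ?_
    rw [e2 p y]
    refine (hG.add_u _ _ _).trans ?_
    rw [norm_neg]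
    exact add_le_add le_rfl (hd p y)
  · rw [ht]
    have := hG.step_s (p * h) h y hh.le
    rw [e1 p y]
    exact (hG.add_s _ _ _).trans (add_le_add this (hd p y))
  · rw [ht]
    have := (hG.step_n (p * h) h y).le
    rw [e1 p y]
    exact (hG.add_n _ _ _).trans (add_le_add this (hd p y))

/-- The composition of the `n` backward steps from grid point `p + n` to grid point `p`. -/
def evol (B : ℕ → X →L[ℝ] X) : ℕ → ℕ → X →L[ℝ] X
  | _, 0 => ContinuousLinearMap.id ℝ X
  | p, n + 1 => B p ∘L evol B (p + 1) n

theorem evol_succ (B : ℕ → X →L[ℝ] X) (p n : ℕ) (x : X) :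
    evol B p (n + 1) x = B p (evol B (p + 1) n x) := rfl

theorem evol_add (B : ℕ → X →L[ℝ] X) (p n m : ℕ) (x : X) :
    evol B p (n + m) x = evol B p n (evol B (p + n) m x) := by
  induction n generalizing p with
  | zero => simp [evol]
  | succ n ih =>
    rw [show n + 1 + m = n + m + 1 by omega, show p + (n + 1) = p + 1 + n by omega, evol_succ,
      evol_succ, ih]

theorem eq_evol {B : ℕ → X →L[ℝ] X} {y : ℕ → X} {p n : ℕ}
    (hy : ∀ q, p ≤ q → q < p + n → y q = B q (y (q + 1))) : y p = evol B p n (y (p + n)) := by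
  induction n generalizing p with
  | zero => rfl
  | succ n ih =>
    rw [evol_succ, hy p le_rfl (by omega),
      ih (p := p + 1) fun q h1 h2 => hy q (by omega) (by omega)]
    congr 3
    omega

variable {B : ℕ → X →L[ℝ] X} {nu ns nn : ℕ → X → ℝ} {μ h δ K κ η : ℝ}

/-- The cone around the unstable component at grid point `p`. -/
def unstableCone (nu ns nn : ℕ → X → ℝ) (κ η : ℝ) (p : ℕ) : Set X :=
  {y | ns p y ≤ κ * nu p y ∧ nn p y ≤ η * nu p y}

theorem IsGridGauge.norm_le_of_mem_cone (G : IsGridGauge B nu ns nn μ h δ K) (hη1 : η ≤ 1)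
    {p : ℕ} {y : X} (hy : y ∈ unstableCone nu ns nn κ η p) : ‖y‖ ≤ K * (2 + κ) * nu p y := by
  have hK := zero_lt_one.trans_le G.one_le
  have h0 := G.nonneg_u p y
  calc ‖y‖ ≤ K * (nu p y + ns p y + nn p y) := G.norm_le p y
    _ ≤ K * (nu p y + κ * nu p y + 1 * nu p y) := by
        gcongr
        · exact hy.1
        · exact hy.2.trans (by gcongr)
    _ = _ := by ring

theorem IsGridGauge.cone_step (G : IsGridGauge B nu ns nn μ h δ K) (hδ : 0 ≤ δ) (hκ : 1 ≤ κ)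
    (hη : 0 ≤ η) (hη1 : η ≤ 1) (hsmall : 2 * (δ * (K * (2 + κ))) ≤ η * (μ * h)) {p : ℕ} {y : X}
    (hy : y ∈ unstableCone nu ns nn κ η (p + 1)) :
    B p y ∈ unstableCone nu ns nn κ η p ∧
      nu (p + 1) y ≤ Real.exp (-(μ / 2) * h) * nu p (B p y) := by
  have hμh : 0 < μ * h := mul_pos G.rate_pos G.h_pos
  have hn := mul_le_mul_of_nonneg_left (G.norm_le_of_mem_cone hη1 hy) hδ
  set a := nu (p + 1) y with ha
  have ha0 : 0 ≤ a := G.nonneg_u _ _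
  set D := δ * (K * (2 + κ)) with hD
  have hK := zero_lt_one.trans_le G.one_le
  have hD0 : 0 ≤ D := by positivity
  have hn' : δ * ‖y‖ ≤ D * a := by rw [hD]; linarith
  have hD1 : 2 * D ≤ μ * h := hsmall.trans (mul_le_of_le_one_left hμh.le hη1)
  have hu := G.step_u p y
  have hexp : 1 + μ * h ≤ Real.exp (μ * h) := by
    have := Real.add_one_le_exp (μ * h); linarith
  have hu1 : (1 + μ * h - D) * a ≤ nu p (B p y) := by nlinarith
  have hes : Real.exp (-μ * h) ≤ 1 := Real.exp_le_one_iff.2 (by linarith)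
  have hs := G.step_s p y
  have hnn := G.step_n p y
  have hsa : ns (p + 1) y ≤ κ * a := hy.1
  have hna : nn (p + 1) y ≤ η * a := hy.2
  have hs0 := G.nonneg_s (p + 1) y
  refine ⟨⟨?_, ?_⟩, ?_⟩
  · have h1 : ns p (B p y) ≤ (κ + D) * a := by nlinarith
    have h2 : (κ + D) * a ≤ κ * ((1 + μ * h - D) * a) := by
      rw [← mul_assoc]
      gcongr
      nlinarith
    exact h1.trans (h2.trans (by gcongr))
  · have h1 : nn p (B p y) ≤ (η + D) * a := by nlinarith
    have h2 : (η + D) * a ≤ η * ((1 + μ * h - D) * a) := by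
      rw [← mul_assoc]
      gcongr
      nlinarith
    exact h1.trans (h2.trans (by gcongr))
  · have e : Real.exp (μ * h) = Real.exp (μ / 2 * h) * Real.exp (μ / 2 * h) := by
      rw [← Real.exp_add]; congr 1; ring
    have h3 : 1 + μ / 2 * h ≤ Real.exp (μ / 2 * h) := by
      have := Real.add_one_le_exp (μ / 2 * h); linarith
    have h4 : Real.exp (μ / 2 * h) * a ≤ nu p (B p y) := by
      have h5 : Real.exp (μ / 2 * h) + D ≤ Real.exp (μ * h) := by rw [e]; nlinarith
      nlinarith
    have h6 : Real.exp (-(μ / 2) * h) * (Real.exp (μ / 2 * h) * a) = a := by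
      rw [← mul_assoc, ← Real.exp_add]; simp
    rw [← h6]
    gcongr

theorem IsGridGauge.cone_evol (G : IsGridGauge B nu ns nn μ h δ K) (hδ : 0 ≤ δ) (hκ : 1 ≤ κ)
    (hη : 0 ≤ η) (hη1 : η ≤ 1) (hsmall : 2 * (δ * (K * (2 + κ))) ≤ η * (μ * h)) {p n : ℕ} {y : X}
    (hy : y ∈ unstableCone nu ns nn κ η (p + n)) :
    evol B p n y ∈ unstableCone nu ns nn κ η p ∧
      nu (p + n) y ≤ Real.exp (-(μ / 2) * (n * h)) * nu p (evol B p n y) := by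
  induction n generalizing p with
  | zero => simpa [evol] using hy
  | succ n ih =>
    rw [show p + (n + 1) = p + 1 + n by omega] at hy ⊢
    obtain ⟨h1, h2⟩ := ih (p := p + 1) hy
    obtain ⟨h3, h4⟩ := G.cone_step hδ hκ hη hη1 hsmall h1
    refine ⟨h3, h2.trans ?_⟩
    rw [evol_succ]
    calc Real.exp (-(μ / 2) * (n * h)) * nu (p + 1) (evol B (p + 1) n y)
        ≤ Real.exp (-(μ / 2) * (n * h)) *
          (Real.exp (-(μ / 2) * h) * nu p (B p (evol B (p + 1) n y))) := by gcongr
      _ = _ := by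
        rw [← mul_assoc, ← Real.exp_add]
        congr 2
        push_cast
        ring

theorem IsGridGauge.eq_zero_of_evol_eq_zero (G : IsGridGauge B nu ns nn μ h δ K) (hδ : 0 ≤ δ)
    (hκ : 1 ≤ κ) (hη : 0 ≤ η) (hη1 : η ≤ 1)
    (hsmall : 2 * (δ * (K * (2 + κ))) ≤ η * (μ * h)) (hzero : ∀ p, nu p 0 = 0) {p n : ℕ} {y : X}
    (hy : y ∈ unstableCone nu ns nn κ η (p + n)) (h0 : evol B p n y = 0) : y = 0 := by
  have h1 := (G.cone_evol hδ hκ hη hη1 hsmall hy).2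
  rw [h0, hzero, mul_zero] at h1
  have h2 := G.norm_le_of_mem_cone hη1 hy
  rw [le_antisymm h1 (G.nonneg_u _ _), mul_zero] at h2
  exact norm_le_zero_iff.1 h2

variable {N : ℕ} {r : ℕ → X} {τ R σ : ℝ}

theorem IsGridGauge.unstable_residual_le (G : IsGridGauge B nu ns nn μ h δ K) (hδ : 0 ≤ δ)
    (hτ : ∀ p < N, ‖r p - B p (r (p + 1))‖ ≤ τ) (hR : ∀ p ≤ N, ‖r p‖ ≤ R)
    (hσ : δ * R + K * τ ≤ σ * h) (hσ0 : 0 ≤ σ) (h0 : nu 0 (r 0) = 0) {p : ℕ} (hp : p ≤ N) :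
    nu p (r p) ≤ σ / μ := by
  have hμ := G.rate_pos
  have hh := G.h_pos
  have hK := zero_lt_one.trans_le G.one_le
  induction p with
  | zero => rw [h0]; positivity
  | succ p ih =>
    have h1 := ih (by omega)
    have h2 := G.step_u p (r (p + 1))
    have h3 : nu p (B p (r (p + 1))) ≤ nu p (r p) + K * τ := by
      have h4 := G.add_u p (r p) (-(r p - B p (r (p + 1))))
      rw [norm_neg, show r p + -(r p - B p (r (p + 1))) = B p (r (p + 1)) by abel] at h4
      exact h4.trans (by gcongr; exact hτ p (by omega))
    have h5 : δ * ‖r (p + 1)‖ ≤ δ * R := by gcongr; exact hR _ hp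
    have h6 : Real.exp (μ * h) * nu (p + 1) (r (p + 1)) ≤ σ / μ + σ * h := by linarith
    have h7 : 1 + μ * h ≤ Real.exp (μ * h) := by
      have := Real.add_one_le_exp (μ * h); linarith
    have h8 : (1 + μ * h) * nu (p + 1) (r (p + 1)) ≤ (1 + μ * h) * (σ / μ) := by
      have e : (1 + μ * h) * (σ / μ) = σ / μ + σ * h := by field_simp
      rw [e]
      refine le_trans ?_ h6
      gcongr
      exact G.nonneg_u _ _
    exact le_of_mul_le_mul_left h8 (by positivity)

theorem IsGridGauge.stable_residual_le (G : IsGridGauge B nu ns nn μ h δ K) (hδ : 0 ≤ δ)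
    (hτ : ∀ p < N, ‖r p - B p (r (p + 1))‖ ≤ τ) (hR : ∀ p ≤ N, ‖r p‖ ≤ R)
    (hσ : δ * R + K * τ ≤ σ * h) (hσ0 : 0 ≤ σ) (hh1 : h ≤ 1) {p n : ℕ} (hp : p + n = N) :
    ns p (r p) ≤ Real.exp (-μ * (n * h)) * ns N (r N) + σ * ((1 + μ) / μ) := by
  have hμ := G.rate_pos
  have hh := G.h_pos
  have hK := zero_lt_one.trans_le G.one_le
  induction n generalizing p with
  | zero =>
    obtain rfl : p = N := by omega
    simp only [Nat.cast_zero, zero_mul, mul_zero, Real.exp_zero, one_mul]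
    have : 0 ≤ σ * ((1 + μ) / μ) := by positivity
    linarith
  | succ n ih =>
    have h1 := ih (p := p + 1) (by omega)
    have h2 := G.step_s p (r (p + 1))
    have h3 : ns p (r p) ≤ ns p (B p (r (p + 1))) + K * τ := by
      have h4 := G.add_s p (B p (r (p + 1))) (r p - B p (r (p + 1)))
      rw [add_sub_cancel] at h4
      exact h4.trans (by gcongr; exact hτ p (by omega))
    have h5 : δ * ‖r (p + 1)‖ ≤ δ * R := by gcongr; exact hR _ (by omega)
    have h6 : Real.exp (-μ * h) * (1 + μ * h) ≤ 1 := by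
      have h7 := Real.add_one_le_exp (μ * h)
      calc Real.exp (-μ * h) * (1 + μ * h) ≤ Real.exp (-μ * h) * Real.exp (μ * h) := by
            gcongr; linarith
        _ = 1 := by rw [← Real.exp_add]; simp
    have h8 : Real.exp (-μ * h) * (σ * ((1 + μ) / μ)) + σ * h ≤ σ * ((1 + μ) / μ) := by
      have h9 : Real.exp (-μ * h) ≤ 1 := Real.exp_le_one_iff.2 (by nlinarith)
      have h10 : Real.exp (-μ * h) * (1 + μ) + μ * h ≤ 1 + μ := by
        have e1 : Real.exp (-μ * h) * (μ * h) ≤ 1 - Real.exp (-μ * h) := by linarith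
        nlinarith [mul_nonneg hμ.le (mul_nonneg hμ.le (sub_nonneg.2 hh1)), Real.exp_pos (-μ * h),
          mul_nonneg (sub_nonneg.2 h9) (mul_nonneg hμ.le (sub_nonneg.2 hh1))]
      have e : Real.exp (-μ * h) * (σ * ((1 + μ) / μ)) + σ * h
          = σ * ((Real.exp (-μ * h) * (1 + μ) + μ * h) / μ) := by field_simp
      rw [e]
      gcongr
    have h11 : Real.exp (-μ * ((n + 1 : ℕ) * h))
        = Real.exp (-μ * h) * Real.exp (-μ * (n * h)) := by
      rw [← Real.exp_add]; congr 1; push_cast; ring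
    have h12 := mul_le_mul_of_nonneg_left h1 (Real.exp_pos (-μ * h)).le
    rw [mul_add, ← mul_assoc, ← h11] at h12
    linarith

theorem IsGridGauge.neutral_residual_le (G : IsGridGauge B nu ns nn μ h δ K) (hδ : 0 ≤ δ)
    (hτ : ∀ p < N, ‖r p - B p (r (p + 1))‖ ≤ τ) (hR : ∀ p ≤ N, ‖r p‖ ≤ R)
    (hσ : δ * R + K * τ ≤ σ * h) {p n : ℕ} (hp : p + n = N) :
    nn p (r p) ≤ nn N (r N) + σ * (n * h) := by
  have hK := zero_lt_one.trans_le G.one_le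
  induction n generalizing p with
  | zero =>
    obtain rfl : p = N := by omega
    simp
  | succ n ih =>
    have h1 := ih (p := p + 1) (by omega)
    have h2 := G.step_n p (r (p + 1))
    have h3 : nn p (r p) ≤ nn p (B p (r (p + 1))) + K * τ := by
      have h4 := G.add_n p (B p (r (p + 1))) (r p - B p (r (p + 1)))
      rw [add_sub_cancel] at h4
      exact h4.trans (by gcongr; exact hτ p (by omega))
    have h5 : δ * ‖r (p + 1)‖ ≤ δ * R := by gcongr; exact hR _ (by omega)
    push_cast
    linarith

end Discrete

section Residual

variable {X : Type*} [NormedAddCommGroup X] [NormedSpace ℝ X]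

theorem exists_residual_bound {μ K C κ G₀ cη : ℝ} (hμ : 0 < μ) (hK : 1 ≤ K) (hC : 0 ≤ C)
    (hκ : 1 ≤ κ) (hG₀ : 0 ≤ G₀) (hcη : 0 ≤ cη) (k : ℕ) :
    ∃ Rm c₁ c₂ c₃ a₀ a₁ : ℝ, 0 ≤ Rm ∧ 0 ≤ c₁ ∧ 0 ≤ c₂ ∧ 0 ≤ c₃ ∧ 0 ≤ a₀ ∧ 0 ≤ a₁ ∧
      ∀ (B : ℕ → X →L[ℝ] X) (nu ns nn : ℕ → X → ℝ) (h : ℝ) (N : ℕ) (r : ℕ → X) (g q : X),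
        IsGridGauge B nu ns nn μ h (K * (C * h ^ (k + 1))) K → h ≤ 1 → cη * h ^ k ≤ 1 →
        h ^ k * (a₀ + a₁ * (N * h)) ≤ 1 / 2 →
        (∀ p < N, ‖r p - B p (r (p + 1))‖ ≤ C * h ^ (k + 1)) →
        nu 0 (r 0) = 0 → r N = q + g → ‖g‖ ≤ G₀ → nn N (q + g) = nn N q →
        q ∈ unstableCone nu ns nn κ (cη * h ^ k) N →
        ∀ p n : ℕ, p + n = N → ‖r p‖ ≤ Rm ∧
          ‖r p‖ ≤ c₁ * Real.exp (-μ * (n * h)) + (c₂ + c₃ * (N * h)) * h ^ k := by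
  have hK0 : 0 < K := zero_lt_one.trans_le hK
  have hκ0 : 0 < κ := zero_lt_one.trans_le hκ
  set K₁ := K * ((κ + 2) * (K * G₀)) with hK₁
  set K₂ := K * ((2 + κ) / μ + (1 + μ) / μ) with hK₂
  have hK₁0 : 0 ≤ K₁ := by positivity
  have hK₂0 : 0 ≤ K₂ := by positivity
  set cσ := 2 * (K * C * (K₁ + 1)) with hcσ
  have hcσ0 : 0 ≤ cσ := by positivity
  set b₀ := κ * (cσ / μ + K * G₀) + K * G₀ with hb₀
  have hb₀0 : 0 ≤ b₀ := by positivity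
  refine ⟨2 * K₁ + 1, K * b₀, K * (cσ / μ + cσ * ((1 + μ) / μ) + cη * (cσ / μ + K * G₀)),
    K * cσ, K * C * K₂, K * C * K, by positivity, by positivity, by positivity, by positivity,
    by positivity, by positivity, ?_⟩
  intro B nu ns nn h N r g q G hh1 hη1 hsmall hτ h0 hrN hg hnn hq
  have hh := G.h_pos
  have hδ : 0 ≤ K * (C * h ^ (k + 1)) := by positivity
  have hhk1 : h ^ k ≤ 1 := pow_le_one₀ hh.le hh1
  have hhk0 : 0 ≤ h ^ k := by positivity
  obtain ⟨p₀, hp₀, hmax⟩ := Finset.exists_max_image (Finset.range (N + 1)) (fun p => ‖r p‖)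
    ⟨0, by simp⟩
  set R := ‖r p₀‖ with hRdef
  have hR0 : 0 ≤ R := norm_nonneg _
  have hR : ∀ p ≤ N, ‖r p‖ ≤ R := fun p hp => hmax p (Finset.mem_range.2 (by omega))
  set σ := K * C * (1 + R) * h ^ k with hσdef
  have hσ0 : 0 ≤ σ := by positivity
  have hσ : K * (C * h ^ (k + 1)) * R + K * (C * h ^ (k + 1)) ≤ σ * h := by
    rw [hσdef, pow_succ]
    exact le_of_eq (by ring)
  have hu := fun p hp => G.unstable_residual_le (p := p) hδ hτ hR hσ hσ0 h0 hp
  have hs := fun p n hp => G.stable_residual_le (p := p) (n := n) hδ hτ hR hσ hσ0 hh1 hp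
  have hn := fun p n hp => G.neutral_residual_le (p := p) (n := n) hδ hτ hR hσ hp
  have hqu : nu N q ≤ σ / μ + K * G₀ := by
    have h1 := G.add_u N (r N) (-g)
    rw [norm_neg, show r N + -g = q by rw [hrN]; abel] at h1
    exact h1.trans (add_le_add (hu N le_rfl) (by gcongr))
  have hqs : ns N (r N) ≤ κ * (σ / μ + K * G₀) + K * G₀ := by
    rw [hrN]
    refine (G.add_s N q g).trans (add_le_add (hq.1.trans ?_) ?_) <;> gcongr
  have hqn : nn N (r N) ≤ cη * h ^ k * (σ / μ + K * G₀) := by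
    rw [hrN, hnn]
    exact hq.2.trans (by gcongr)
  have hbound : ∀ p n : ℕ, p + n = N → ‖r p‖ ≤ K * (σ / μ
      + (Real.exp (-μ * (n * h)) * (κ * (σ / μ + K * G₀) + K * G₀) + σ * ((1 + μ) / μ))
      + (cη * h ^ k * (σ / μ + K * G₀) + σ * (N * h))) := by
    intro p n hp
    refine (G.norm_le p (r p)).trans ?_
    have hnN : (n : ℝ) ≤ N := by exact_mod_cast (by omega : n ≤ N)
    have h1 := hu p (by omega)
    have h2 := hs p n hp
    have h3 := hn p n hp
    gcongr
    · exact h2.trans (by gcongr)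
    · exact h3.trans (by gcongr)
  have hRle : 1 + R ≤ 2 * (K₁ + 1) := by
    have hp₀N : p₀ ≤ N := by
      have := Finset.mem_range.1 hp₀; omega
    have h1 := hbound p₀ (N - p₀) (by omega)
    have hexp : Real.exp (-μ * ((N - p₀ : ℕ) * h)) ≤ 1 := by
      refine Real.exp_le_one_iff.2 ?_
      have : 0 ≤ μ * ((N - p₀ : ℕ) * h) := by positivity
      linarith
    have h2 : R ≤ K * (σ / μ
        + (1 * (κ * (σ / μ + K * G₀) + K * G₀) + σ * ((1 + μ) / μ))
        + (1 * (σ / μ + K * G₀) + σ * (N * h))) := h1.trans (by gcongr)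
    have h3 : R ≤ K₁ + σ * (K₂ + K * (N * h)) := by
      refine h2.trans (le_of_eq ?_)
      rw [hK₁, hK₂]
      field_simp
      ring
    have h4 : σ * (K₂ + K * (N * h)) ≤ (1 + R) * (1 / 2) := by
      calc σ * (K₂ + K * (N * h))
          = (1 + R) * (h ^ k * (K * C * K₂ + K * C * K * (N * h))) := by rw [hσdef]; ring
        _ ≤ _ := by gcongr
    linarith
  have hσle : σ ≤ cσ * h ^ k := by
    rw [hσdef, hcσ]
    calc K * C * (1 + R) * h ^ k ≤ K * C * (2 * (K₁ + 1)) * h ^ k := by gcongr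
      _ = _ := by ring
  have hσle' : σ ≤ cσ := hσle.trans (mul_le_of_le_one_right hcσ0 hhk1)
  intro p n hp
  refine ⟨(hR p (by omega)).trans (by linarith), (hbound p n hp).trans ?_⟩
  calc K * (σ / μ
      + (Real.exp (-μ * (n * h)) * (κ * (σ / μ + K * G₀) + K * G₀) + σ * ((1 + μ) / μ))
      + (cη * h ^ k * (σ / μ + K * G₀) + σ * (N * h)))
      ≤ K * (cσ * h ^ k / μ
      + (Real.exp (-μ * (n * h)) * (κ * (cσ / μ + K * G₀) + K * G₀)
        + cσ * h ^ k * ((1 + μ) / μ))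
      + (cη * h ^ k * (cσ / μ + K * G₀) + cσ * h ^ k * (N * h))) := by gcongr
    _ = _ := by rw [hb₀]; ring

end Residual

section LinearAlgebra

variable {X : Type*} [NormedAddCommGroup X] [InnerProductSpace ℝ X]

theorem exists_mem_forall_inner_sub_eq_zero [FiniteDimensional ℝ X] {W V : Submodule ℝ X}
    (hd : Module.finrank ℝ W = Module.finrank ℝ V)
    (hinj : ∀ w ∈ W, (∀ v ∈ V, ⟪w, v⟫ = 0) → w = 0) (e : X) :
    ∃ w ∈ W, ∀ v ∈ V, ⟪e - w, v⟫ = 0 := by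
  have hort : ∀ x, (V.orthogonalProjectionOnto x = 0) → ∀ v ∈ V, ⟪x, v⟫ = 0 := fun x hx v hv =>
    Submodule.inner_left_of_mem_orthogonal hv (Submodule.orthogonalProjectionOnto_eq_zero_iff.1 hx)
  set P : W →ₗ[ℝ] V := (V.orthogonalProjectionOnto : X →ₗ[ℝ] V) ∘ₗ W.subtype with hP
  have hPi : Function.Injective P := by
    rw [← LinearMap.ker_eq_bot, LinearMap.ker_eq_bot']
    intro w hw
    exact Subtype.ext (hinj w w.2 (hort w hw))
  obtain ⟨w, hw⟩ := (LinearMap.injective_iff_surjective_of_finrank_eq_finrank hd).1 hPi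
    (V.orthogonalProjectionOnto e)
  refine ⟨w, w.2, hort _ ?_⟩
  rw [map_sub, sub_eq_zero]
  exact hw.symm

theorem finrank_span_image_lt {m n : ℕ} (hnm : n ≤ m) {Q : Fin m → X} (hQ : Orthonormal ℝ Q) :
    Module.finrank ℝ (Submodule.span ℝ (Q '' {j | (j : ℕ) < n})) = n := by
  have h1 : Q '' {j | (j : ℕ) < n} = Set.range (Q ∘ Fin.castLE hnm) := by
    ext x
    constructor
    · rintro ⟨j, hj, rfl⟩
      exact ⟨⟨j, hj⟩, rfl⟩
    · rintro ⟨j, rfl⟩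
      exact ⟨Fin.castLE hnm j, j.2, rfl⟩
  rw [h1, finrank_span_eq_card (hQ.linearIndependent.comp _ (Fin.castLE_injective hnm)),
    Fintype.card_fin]

end LinearAlgebra

section March

variable {X : Type*} [NormedAddCommGroup X] [InnerProductSpace ℝ X] {f : X → ℝ → X}
  {J : X → ℝ → ℝ} {s Jbar : ℝ} {u : ℝ → X} {S : AdjointScheme X} {T : ℝ} {N M nu m : ℕ}

/-- The step of the scheme from grid point `p + 1` to grid point `p`. -/
def AdjointScheme.gridStep (S : AdjointScheme X) (h : ℝ) (p : ℕ) : X →L[ℝ] X := S.A h (p * h)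

namespace StabilizedMarch

variable (P : StabilizedMarch f J s Jbar u S T N M nu m)

/-- The span of the columns kept as unstable at break point `i`. -/
def unstableSpan (i : ℕ) : Submodule ℝ X := Submodule.span ℝ (P.Q i '' {j | (j : ℕ) < nu})

theorem evol_segment_mem {i : ℕ} (hi : i < P.K + P.L) {x : X} (hx : x ∈ P.unstableSpan (i + 1)) :
    evol (S.gridStep (T / N)) (P.brk i) (P.brk (i + 1) - P.brk i) x ∈ P.unstableSpan i := by
  have hlt := P.brk_lt i hi
  suffices P.unstableSpan (i + 1) ≤ (P.unstableSpan i).comap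
      (evol (S.gridStep (T / N)) (P.brk i) (P.brk (i + 1) - P.brk i) : X →ₗ[ℝ] X) from this hx
  refine Submodule.span_le.2 ?_
  rintro _ ⟨j, hj, rfl⟩
  have h1 := eq_evol (B := S.gridStep (T / N)) (y := fun p => P.Y i p j) (p := P.brk i)
    (n := P.brk (i + 1) - P.brk i) fun q hq hq' => P.Y_step i hi q hq (by omega) j
  simp only [Nat.add_sub_cancel' hlt.le, P.Y_terminal i hi j] at h1
  change evol (S.gridStep (T / N)) (P.brk i) (P.brk (i + 1) - P.brk i) (P.Q (i + 1) j)
    ∈ P.unstableSpan i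
  rw [← h1, P.qr i hi j]
  refine Submodule.sum_mem _ fun l _ => ?_
  rcases le_or_gt l j with hl | hl
  · exact Submodule.smul_mem _ _ (Submodule.subset_span ⟨l, (Fin.le_def.1 hl).trans_lt hj, rfl⟩)
  · rw [P.R_upper i hi l j hl, zero_smul]
    exact zero_mem _

theorem brk_le {i j : ℕ} (hij : i ≤ j) (hj : j ≤ P.K + P.L) : P.brk i ≤ P.brk j := by
  induction j, hij using Nat.le_induction with
  | base => exact le_rfl
  | succ j hij ih => exact (ih (by omega)).trans (P.brk_lt j (by omega)).le

theorem evol_mem {i n : ℕ} (hi : i + n = P.K + P.L) {x : X}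
    (hx : x ∈ P.unstableSpan (P.K + P.L)) :
    evol (S.gridStep (T / N)) (P.brk i) (N + M - P.brk i) x ∈ P.unstableSpan i := by
  induction n generalizing i with
  | zero =>
    obtain rfl : i = P.K + P.L := by omega
    rw [P.brk_end, Nat.sub_self]
    exact hx
  | succ n ih =>
    have h1 := P.evol_segment_mem (i := i) (by omega) (ih (i := i + 1) (by omega))
    have h2 := P.brk_lt i (by omega)
    have h3 := P.brk_le (i := i + 1) (j := P.K + P.L) (by omega) le_rfl
    rw [P.brk_end] at h3
    have h4 := evol_add (S.gridStep (T / N)) (P.brk i) (P.brk (i + 1) - P.brk i)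
      (N + M - P.brk (i + 1)) x
    rw [show P.brk i + (P.brk (i + 1) - P.brk i) = P.brk (i + 1) by omega,
      show P.brk (i + 1) - P.brk i + (N + M - P.brk (i + 1)) = N + M - P.brk i by omega] at h4
    rwa [h4]

/-- If the backward evolution is injective on the initialization, then every vector in the
unstable span at a break point evolves from the initialization. -/
theorem exists_eq_evol (hm : nu ≤ m) {i : ℕ} (hi : i ≤ P.K + P.L)
    (hinj : ∀ x ∈ P.unstableSpan (P.K + P.L),
      evol (S.gridStep (T / N)) (P.brk i) (N + M - P.brk i) x = 0 → x = 0)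
    {w : X} (hw : w ∈ P.unstableSpan i) :
    ∃ x ∈ P.unstableSpan (P.K + P.L),
      evol (S.gridStep (T / N)) (P.brk i) (N + M - P.brk i) x = w := by
  set E := (evol (S.gridStep (T / N)) (P.brk i) (N + M - P.brk i) : X →ₗ[ℝ] X) with hE
  have hfin : ∀ i ≤ P.K + P.L, Module.finrank ℝ (P.unstableSpan i) = nu := fun i hi =>
    finrank_span_image_lt hm (P.Q_orthonormal i hi)
  have hfd : ∀ i, FiniteDimensional ℝ (P.unstableSpan i) := fun i =>
    FiniteDimensional.span_of_finite ℝ (Set.toFinite _)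
  have := hfd i
  have := hfd (P.K + P.L)
  set E' : P.unstableSpan (P.K + P.L) →ₗ[ℝ] P.unstableSpan i :=
    E.restrict (p := P.unstableSpan (P.K + P.L)) (q := P.unstableSpan i)
      (fun x hx => P.evol_mem (i := i) (n := P.K + P.L - i) (by omega) hx) with hE'
  have hinj' : Function.Injective E' := by
    rw [← LinearMap.ker_eq_bot, LinearMap.ker_eq_bot']
    intro x hx
    exact Subtype.ext (hinj x x.2 (congrArg Subtype.val hx))
  obtain ⟨x, hx⟩ := (LinearMap.injective_iff_surjective_of_finrank_eq_finrank
    ((hfin _ le_rfl).trans (hfin i hi).symm)).1 hinj' ⟨w, hw⟩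
  exact ⟨x, x.2, congrArg Subtype.val hx⟩

theorem exists_segment {n p : ℕ} (hp : p < P.brk n) : ∃ i < n, P.brk i ≤ p ∧ p < P.brk (i + 1) := by
  induction n with
  | zero => rw [P.brk_zero] at hp; omega
  | succ n ih =>
    rcases lt_or_ge p (P.brk n) with h | h
    · obtain ⟨i, hi, h'⟩ := ih h
      exact ⟨i, by omega, h'⟩
    · exact ⟨n, by omega, h, hp⟩

theorem psi_step {p : ℕ} (hp : p < N) :
    P.ψ p = S.gridStep (T / N) p (P.ψ (p + 1)) + S.g (T / N) (p * (T / N)) := by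
  obtain ⟨i, hi, h1, h2⟩ := P.exists_segment (n := P.K) (by rwa [P.brk_K])
  rw [P.ψ_eq i hi p h1 h2.le, P.ψ_eq i hi (p + 1) (by omega) h2, P.v_step i hi p h1 h2, map_add,
    map_sum, add_assoc]
  simp only [map_smul]
  congr 1
  exact Finset.sum_congr rfl fun j _ => by rw [P.Y_step i (by omega) p h1 h2 j]; rfl

theorem K_pos (hN : 0 < N) : 0 < P.K := by
  rcases Nat.eq_zero_or_pos P.K with h | h
  · have := P.brk_K
    rw [h, P.brk_zero] at this
    omega
  · exact h

theorem psi_terminal (hN : 0 < N) : ∃ q ∈ P.unstableSpan P.K, P.ψ N = q + P.γ P.K := by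
  have hK := P.K_pos hN
  obtain ⟨i, hi⟩ : ∃ i, P.K = i + 1 := ⟨P.K - 1, by omega⟩
  have hb : P.brk (i + 1) = N := by rw [← hi, P.brk_K]
  have h1 := P.ψ_eq i (by omega) N (by have := P.brk_lt i (by omega); omega) hb.ge
  refine ⟨∑ j, P.a P.K j • P.Q P.K j, Submodule.sum_mem _ fun j _ => ?_, ?_⟩
  · rcases lt_or_ge (j : ℕ) nu with hj | hj
    · exact Submodule.smul_mem _ _ (Submodule.subset_span ⟨j, hj, rfl⟩)
    · rw [P.a_terminal j hj, zero_smul]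
      exact zero_mem _
  · have hv := P.v_terminal i (by omega)
    have hY := P.Y_terminal i (by omega)
    rw [hb] at hv hY
    rw [h1, hv, hi]
    simp only [hY]

theorem inner_psi_zero (hN : 0 < N) {w : X} (hw : w ∈ P.unstableSpan 0) : ⟪w, P.ψ 0⟫ = 0 := by
  have hK := P.K_pos hN
  have h1 : P.ψ 0 = ∑ l, (P.b 0 l + P.a 0 l) • P.Q 0 l + P.v 0 0 := by
    rw [P.ψ_eq 0 hK 0 P.brk_zero.le (Nat.zero_le _)]
    congr 1
    have h2 : ∀ j, P.Y 0 0 j = ∑ l, P.R 0 l j • P.Q 0 l := fun j => by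
      have := P.qr 0 (by omega) j
      rwa [P.brk_zero] at this
    simp only [h2, Finset.smul_sum, smul_smul]
    rw [Finset.sum_comm]
    refine Finset.sum_congr rfl fun l _ => ?_
    have h3 := congrFun (P.march 0 hK) l
    simp only [Matrix.mulVec, dotProduct, Pi.add_apply] at h3
    rw [← Finset.sum_smul, ← h3]
    congr 1
    exact Finset.sum_congr rfl fun j _ => mul_comm _ _
  induction hw using Submodule.span_induction with
  | mem x hx =>
    obtain ⟨j, hj, rfl⟩ := hx
    have h4 := P.b_eq 0 hK j
    rw [P.brk_zero] at h4
    rw [h1, inner_add_right, (P.Q_orthonormal 0 (Nat.zero_le _)).inner_right_fintype, h4,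
      P.a_initial j hj]
    ring
  | zero => exact inner_zero_left _
  | add x y _ _ hx hy => rw [inner_add_left, hx, hy, add_zero]
  | smul c x _ hx => rw [inner_smul_left, hx, mul_zero]

theorem inner_init_eq_zero {q : X} (hq : q ∈ P.unstableSpan (P.K + P.L)) :
    ⟪q, f (u (((N + M : ℕ) : ℝ) * (T / N))) s⟫ = 0 := by
  induction hq using Submodule.span_induction with
  | mem x hx =>
    obtain ⟨j, -, rfl⟩ := hx
    exact P.Q_init j
  | zero => exact inner_zero_left _
  | add x y _ _ hx hy => rw [inner_add_left, hx, hy, add_zero]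
  | smul c x _ hx => rw [inner_smul_left, hx, mul_zero]

end StabilizedMarch

end March

section Main

variable {X : Type*} [NormedAddCommGroup X] [InnerProductSpace ℝ X] [FiniteDimensional ℝ X]
  [CompleteSpace X] {f : X → ℝ → X} {J : X → ℝ → ℝ} {s : ℝ} {k : ℕ} {Λ : Set X}
  {Es Eu : X → Submodule ℝ X} {u ψinf : ℝ → X} {Jbar : ℝ} {S : AdjointScheme X}

theorem exists_small_step {k : ℕ} (hk : 1 ≤ k) {h₀ a b : ℝ} (hh₀ : 0 < h₀) (ha : 0 ≤ a)
    (hb : 0 ≤ b) :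
    ∃ δ : ℝ, 0 < δ ∧ ∀ h : ℝ, 0 < h → h < δ →
      h < h₀ ∧ h ≤ 1 ∧ a * h ^ k ≤ 1 ∧ h ^ k * b ≤ 1 / 2 := by
  refine ⟨min h₀ (min 1 (min (1 / (a + 1)) (1 / (2 * (b + 1))))), by positivity,
    fun h hh hlt => ?_⟩
  simp only [lt_min_iff] at hlt
  obtain ⟨h1, h2, h3, h4⟩ := hlt
  have hpow : h ^ k ≤ h := by
    calc h ^ k ≤ h ^ 1 := pow_le_pow_of_le_one hh.le h2.le hk
      _ = h := pow_one h
  rw [lt_div_iff₀ (by positivity)] at h3 h4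
  refine ⟨h1, h2.le, ?_, ?_⟩
  · nlinarith [mul_le_mul_of_nonneg_left hpow ha]
  · nlinarith [mul_le_mul_of_nonneg_left hpow hb]

set_option maxHeartbeats 1000000 in
/-- The grid function computed by the stabilized march is close to the adjoint shadowing direction,
up to boundary layers at both ends of the time interval. -/
theorem exists_march_error_bound (hk : 1 ≤ k)
    (hf : ∀ x ∈ Λ, ContDiffAt ℝ 1 (fun x => f x s) x)
    (hJ : ∀ x ∈ Λ, ContDiffAt ℝ 1 (fun x => J x s) x)
    (hyp : IsUniformlyHyperbolic (fun x => f x s) Λ Es Eu)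
    (hu : IsOrbit (fun x => f x s) Λ u)
    {nu : ℕ} (hnu : Module.finrank ℝ (Eu (u 0)) = nu)
    (hJbar : Tendsto (fun T : ℝ => (1 / T) * ∫ t in (0 : ℝ)..T, J (u t) s) atTop (𝓝 Jbar))
    (hψ : IsAdjointShadowing f J s Es Eu u ψinf) (hS : S.HasOrder k f J s u)
    {c : ℝ} (hc : 0 < c) :
    ∃ c₁ c₂ c₃ α : ℝ, 0 ≤ c₁ ∧ 0 ≤ c₂ ∧ 0 ≤ c₃ ∧ 0 < α ∧ ∀ T : ℝ, 0 < T →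
      ∃ δ : ℝ, 0 < δ ∧ δ ≤ 1 ∧ ∀ N : ℕ, 0 < N → T / N < δ → ∀ (M m : ℕ), nu ≤ m →
        ∀ P : StabilizedMarch f J s Jbar u S T N M nu m, P.Nondegenerate Es Eu c →
          ∀ p ≤ N, ‖P.ψ p - ψinf (p * (T / N))‖
            ≤ c₁ * (Real.exp (-α * (p * (T / N))) + Real.exp (-α * (T - p * (T / N))))
              + (c₂ + c₃ * T) * (T / N) ^ k := by
  obtain ⟨Φ, μ, K, Nu, Ns, Nn, hG, hself, hΦ⟩ := hyp.exists_orbit_gauge hu hf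
  obtain ⟨C, hC0, h₀, hh₀, hstep⟩ := hS.exists_step hψ.adjoint_eq hψ.bounded hself hΦ
  obtain ⟨Bψ, hBψ⟩ := hψ.bounded
  obtain ⟨BJ, hBJ0, hBJ⟩ := exists_norm_comp_orbit_le hyp.compact hu
    (G := fun x => J x s) fun x hx => (hJ x hx).continuousAt
  obtain ⟨m₀, hm₀, hfm⟩ := exists_le_norm_comp_orbit hyp.compact hu
    (G := fun x => f x s) (fun x hx => (hf x hx).continuousAt) hyp.ne_zero
  have hBψ0 : 0 ≤ Bψ := (norm_nonneg _).trans (hBψ 0 le_rfl)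
  have hμ := hG.rate_pos
  have hK1 := hG.one_le
  have hK0 : 0 < K := zero_lt_one.trans_le hK1
  set κ := max 1 (K * K / c) with hκdef
  have hκ : 1 ≤ κ := le_max_left _ _
  set cη := 2 * (K * C * (K * (2 + κ))) / μ with hcη
  have hcη0 : 0 ≤ cη := by positivity
  set G₀ := (|Jbar| + BJ) / m₀ + Bψ with hG₀
  have hG₀0 : 0 ≤ G₀ := by positivity
  obtain ⟨Rm, d₁, d₂, d₃, a₀, a₁, hRm, hd₁, hd₂, hd₃, ha₀, ha₁, hres⟩ :=
    exists_residual_bound (X := X) hμ hK1 hC0 hκ hG₀0 hcη0 k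
  refine ⟨d₁ + K * (2 + κ) * (K * (Rm + Bψ)), d₂, d₃, μ / 2, by positivity, hd₂, hd₃,
    half_pos hμ, fun T hT => ?_⟩
  obtain ⟨δ, hδ0, hδ⟩ := exists_small_step hk hh₀ hcη0 (b := a₀ + a₁ * T) (by positivity)
  refine ⟨min δ 1, by positivity, min_le_right _ _, fun N hN hlt M m hm P hP => ?_⟩
  have hNpos : (0 : ℝ) < N := by exact_mod_cast hN
  set h := T / N with hhdef
  have hh : 0 < h := by positivity
  have hNh : N * h = T := by rw [hhdef]; field_simp
  obtain ⟨hhh₀, hh1, hη1, hsm⟩ := hδ h hh (hlt.trans_le (min_le_left _ _))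
  set η := cη * h ^ k with hη
  have hη0 : 0 ≤ η := by positivity
  have G := hG.isGridGauge (A := S.A h) hh (fun t ht => (hstep h hh hhh₀ t ht).1)
  set B : ℕ → X →L[ℝ] X := S.gridStep h with hB
  change IsGridGauge B _ _ _ _ _ _ _ at G
  set gu : ℕ → X → ℝ := fun p y => Nu (p * h) y with hgu
  set gs : ℕ → X → ℝ := fun p y => Ns (p * h) y with hgs
  set gn : ℕ → X → ℝ := fun p y => Nn (p * h) y with hgn
  have hδ' : 0 ≤ K * (C * h ^ (k + 1)) := by positivity
  have hsmall : 2 * (K * (C * h ^ (k + 1)) * (K * (2 + κ))) ≤ η * (μ * h) := by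
    rw [hη, hcη, pow_succ]
    refine le_of_eq ?_
    field_simp
  have hu0 : ∀ p, gu p 0 = 0 := fun p => hG.zero_u _
  -- the initialization lies in the unstable cone
  have hinit : ∀ x ∈ P.unstableSpan (P.K + P.L), x ∈ unstableCone gu gs gn κ η (N + M) := by
    intro x hx
    have h1 : c * ‖x‖ ≤ K * gu (N + M) x := hG.le_u _ x c fun w hw =>
      hP x hx w (hyp.unstable_orthogonal_le (hu _).1 hw)
    have h2 : gs (N + M) x ≤ K * ‖x‖ := by
      have := hG.add_s ((N + M : ℕ) * h) 0 x
      rwa [zero_add, hG.zero_s, zero_add] at this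
    have h0 : 0 ≤ gu (N + M) x := G.nonneg_u _ _
    refine ⟨?_, ?_⟩
    · calc gs (N + M) x ≤ K * (c * ‖x‖) / c := h2.trans (le_of_eq (by field_simp))
        _ ≤ K * (K * gu (N + M) x) / c := by gcongr
        _ = K * K / c * gu (N + M) x := by ring
        _ ≤ κ * gu (N + M) x := by gcongr; exact le_max_right _ _
    · have h3 : gn (N + M) x = 0 := by
        simp only [hgn]
        rw [hG.neutral, P.inner_init_eq_zero hx, abs_zero]
      rw [h3]
      positivity
  have hinj : ∀ p n, p + n = N + M → ∀ x ∈ P.unstableSpan (P.K + P.L), evol B p n x = 0 →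
      x = 0 := fun p n hpn x hx h0 =>
    G.eq_zero_of_evol_eq_zero hδ' hκ hη0 hη1 hsmall hu0 (p := p) (n := n)
      (by rw [hpn]; exact hinit x hx) h0
  have hbrk : ∀ i ≤ P.K + P.L, P.brk i + (N + M - P.brk i) = N + M := fun i hi => by
    have := P.brk_le hi le_rfl
    rw [P.brk_end] at this
    omega
  have hspan : ∀ i ≤ P.K + P.L, ∀ w ∈ P.unstableSpan i,
      w ∈ unstableCone gu gs gn κ η (P.brk i) := by
    intro i hi w hw
    obtain ⟨x, hx, rfl⟩ := P.exists_eq_evol hm hi (hinj _ _ (hbrk i hi)) hw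
    exact (G.cone_evol hδ' hκ hη0 hη1 hsmall (by rw [hbrk i hi]; exact hinit x hx)).1
  set e : ℕ → X := fun p => P.ψ p - ψinf (p * h) with he
  have hestep : ∀ p < N, ‖e p - B p (e (p + 1))‖ ≤ C * h ^ (k + 1) := by
    intro p hp
    have h1 := (hstep h hh hhh₀ (p * h) (by positivity)).2
    have h2 : e p - B p (e (p + 1))
        = S.A h (p * h) (ψinf (p * h + h)) + S.g h (p * h) - ψinf (p * h) := by
      simp only [he]
      rw [P.psi_step hp, map_sub, show ((p + 1 : ℕ) : ℝ) * h = p * h + h by push_cast; ring]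
      change _ - _ - (_ - S.A h (p * h) _) = _
      abel
    rwa [h2]
  -- the unstable component of the error at the initial time
  obtain ⟨w, hw, hwE⟩ := exists_mem_forall_inner_sub_eq_zero (W := P.unstableSpan 0)
    (V := Eu (u 0)) ((finrank_span_image_lt hm (P.Q_orthonormal 0 (Nat.zero_le _))).trans hnu.symm)
    (fun w hw hwv => by
      have h1 := hspan 0 (Nat.zero_le _) w hw
      rw [P.brk_zero] at h1
      have h2 := G.norm_le_of_mem_cone hη1 h1
      have h3 : gu 0 w = 0 := hG.u_eq_zero _ w (by simpa using hwv)
      rw [h3, mul_zero] at h2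
      exact norm_le_zero_iff.1 h2) (e 0)
  obtain ⟨x, hx, hxw⟩ := P.exists_eq_evol hm (Nat.zero_le _) (hinj _ _ (hbrk 0 (Nat.zero_le _))) hw
  rw [P.brk_zero, Nat.sub_zero] at hxw
  set y : ℕ → X := fun p => evol B p (N + M - p) x with hy
  have hy0 : y 0 = w := hxw
  have hystep : ∀ p < N, y p = B p (y (p + 1)) := fun p hp => by
    simp only [hy]
    rw [show N + M - p = N + M - (p + 1) + 1 by omega, evol_succ]
  have hycone : ∀ p ≤ N, y p ∈ unstableCone gu gs gn κ η p := fun p hp =>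
    (G.cone_evol hδ' hκ hη0 hη1 hsmall (p := p) (n := N + M - p)
      (by rw [show p + (N + M - p) = N + M by omega]; exact hinit x hx)).1
  have hydecay : ∀ p ≤ N, gu p (y p) ≤ Real.exp (-(μ / 2) * (p * h)) * gu 0 w := fun p hp => by
    have h1 := (G.cone_evol hδ' hκ hη0 hη1 hsmall (p := 0) (n := p) (y := y p)
      (by rw [zero_add]; exact hycone p hp)).2
    have h2 : evol B 0 p (y p) = w := by
      have h3 := evol_add B 0 p (N + M - p) x
      rw [zero_add, show p + (N + M - p) = N + M by omega] at h3
      rw [← hxw, h3]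
    rwa [h2, zero_add] at h1
  have hyK : y N ∈ P.unstableSpan P.K := by
    have := P.evol_mem (i := P.K) (n := P.L) rfl hx
    rwa [P.brk_K] at this
  obtain ⟨q, hq, hqψ⟩ := P.psi_terminal hN
  have hr0 : gu 0 (e 0 - y 0) = 0 := hG.u_eq_zero _ _ (by rw [hy0]; simpa using hwE)
  have hfT : ‖f (u T) s‖ ≠ 0 := (hm₀.trans_le (hfm T)).ne'
  have hg : ‖P.γ P.K - ψinf (N * h)‖ ≤ G₀ := by
    refine (norm_sub_le _ _).trans (add_le_add ?_ (hBψ _ (by positivity)))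
    rw [P.γ_terminal, norm_smul, Real.norm_eq_abs, abs_div, abs_pow, abs_norm]
    have e1 : |Jbar - J (u T) s| / ‖f (u T) s‖ ^ 2 * ‖f (u T) s‖
        = |Jbar - J (u T) s| / ‖f (u T) s‖ := by field_simp
    rw [e1]
    gcongr
    · exact (abs_sub _ _).trans (by gcongr; exact hBJ T)
    · exact hfm T
  have hgn0 : ⟪P.γ P.K - ψinf (N * h), f (u (N * h)) s⟫ = 0 := by
    rw [hNh, inner_sub_left, hψ.inner_eq hu (fun x hx => (hf x hx).differentiableAt one_ne_zero)
      (fun x hx => (hJ x hx).differentiableAt one_ne_zero) hJbar hT.le, P.γ_terminal,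
      real_inner_smul_left, real_inner_self_eq_norm_sq]
    field_simp
    ring
  have key := hres B gu gs gn h N (fun p => e p - y p) (P.γ P.K - ψinf (N * h)) (q - y N)
    G hh1 hη1 (by rw [hNh]; exact hsm)
    (fun p hp => by
      have h1 : e p - y p - B p (e (p + 1) - y (p + 1)) = e p - B p (e (p + 1)) := by
        rw [map_sub, hystep p hp]; abel
      rw [h1]
      exact hestep p hp)
    hr0 (by simp only [he]; rw [hqψ]; abel) hg
    (by
      simp only [hgn]
      rw [hG.neutral, hG.neutral, inner_add_left, hgn0, add_zero])
    (by
      have := hspan P.K (by omega) _ (Submodule.sub_mem _ hq hyK)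
      rwa [P.brk_K] at this)
  have hwle : ‖w‖ ≤ Rm + Bψ := by
    have h1 := P.inner_psi_zero hN hw
    have h2 : P.ψ 0 = w + ((e 0 - y 0) + ψinf 0) := by
      simp only [he]
      rw [hy0, Nat.cast_zero, zero_mul]
      abel
    rw [h2, inner_add_right, real_inner_self_eq_norm_mul_norm] at h1
    have h3 : ‖(e 0 - y 0) + ψinf 0‖ ≤ Rm + Bψ :=
      (norm_add_le _ _).trans (add_le_add (key 0 N (zero_add N)).1 (hBψ 0 le_rfl))
    have h4 := (abs_le.1 (abs_real_inner_le_norm w ((e 0 - y 0) + ψinf 0))).1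
    rcases (norm_nonneg w).eq_or_lt with h5 | h5
    · rw [← h5]; positivity
    · refine le_of_mul_le_mul_left ?_ h5
      calc ‖w‖ * ‖w‖ ≤ ‖w‖ * ‖(e 0 - y 0) + ψinf 0‖ := by linarith
        _ ≤ _ := by gcongr
  intro p hp
  have hpN : (p : ℝ) ≤ N := by exact_mod_cast hp
  have hcast : ((N - p : ℕ) : ℝ) * h = T - p * h := by
    rw [Nat.cast_sub hp, sub_mul, hNh]
  have k1 := (key p (N - p) (by omega)).2
  rw [hcast, hNh] at k1
  have hTp : 0 ≤ T - p * h := by rw [← hcast]; positivity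
  have k2 : ‖y p‖ ≤ K * (2 + κ) * (K * (Rm + Bψ)) * Real.exp (-(μ / 2) * (p * h)) := by
    have h0w : gu 0 w ≤ K * ‖w‖ := by
      have := hG.add_u ((0 : ℕ) * h) 0 w
      rwa [zero_add, hG.zero_u, zero_add] at this
    calc ‖y p‖ ≤ K * (2 + κ) * gu p (y p) := G.norm_le_of_mem_cone hη1 (hycone p hp)
      _ ≤ K * (2 + κ) * (Real.exp (-(μ / 2) * (p * h)) * (K * (Rm + Bψ))) := by
        gcongr
        exact (hydecay p hp).trans (by gcongr; exact h0w.trans (by gcongr))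
      _ = _ := by ring
  have k3 : Real.exp (-μ * (T - p * h)) ≤ Real.exp (-(μ / 2) * (T - p * h)) := by
    refine Real.exp_le_exp.2 ?_
    nlinarith
  have k4 : ‖P.ψ p - ψinf (p * h)‖ ≤ ‖e p - y p‖ + ‖y p‖ := by
    have := norm_add_le (e p - y p) (y p)
    rwa [sub_add_cancel] at this
  set E₁ := Real.exp (-(μ / 2) * (p * h))
  set E₂ := Real.exp (-(μ / 2) * (T - p * h))
  have hE₁ : 0 ≤ E₁ := (Real.exp_pos _).le
  have hE₂ : 0 ≤ E₂ := (Real.exp_pos _).le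
  set D := K * (2 + κ) * (K * (Rm + Bψ)) with hD
  have hD0 : 0 ≤ D := by positivity
  have k5 := mul_le_mul_of_nonneg_left k3 hd₁
  nlinarith [mul_nonneg hd₁ hE₁, mul_nonneg hD0 hE₂]

end Main

theorem IsQuadrature.sum_weights_le {Cq : ℝ} {k : ℕ} {T : ℝ} {N : ℕ} {w : ℕ → ℝ}
    (hw : IsQuadrature Cq k T N w) (hT : 0 < T) (hh : 0 ≤ T / N) (hh1 : T / N ≤ 1) :
    ∑ p ∈ Finset.range (N + 1), w p ≤ (1 + |Cq|) * T := by
  have h := hw.sum_exp_le hT 0 0 (by simp)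
  have h1 : (T / N) ^ k ≤ 1 := pow_le_one₀ hh hh1
  simp only [zero_mul, add_zero, Real.exp_zero, mul_one, intervalIntegral.integral_const, sub_zero,
    smul_eq_mul, abs_zero, zero_le_one, sup_of_le_left, one_pow] at h
  refine h.trans ?_
  have : |Cq| * T * (T / N) ^ k ≤ |Cq| * T * 1 := by gcongr
  linarith

/-- The boundary layers contribute a bounded amount to the discretized integral. -/
theorem IsQuadrature.sum_layers_le {Cq : ℝ} {k : ℕ} {T : ℝ} {N : ℕ} {w : ℕ → ℝ}
    (hw : IsQuadrature Cq k T N w) (hT : 0 < T) {α : ℝ} (hα : 0 < α) :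
    ∑ p ∈ Finset.range (N + 1),
        w p * (Real.exp (-α * (p * (T / N))) + Real.exp (-α * (T - p * (T / N))))
      ≤ 2 * (1 / α + |Cq| * T * (max 1 α) ^ k * (T / N) ^ k) := by
  have h1 := hw.sum_exp_le hT (-α) 0 fun t ht => by nlinarith [ht.1]
  have h2 := hw.sum_exp_le hT α (-(α * T)) fun t ht => by nlinarith [ht.2]
  have i1 := integral_exp_affine_le (neg_ne_zero.2 hα.ne') (d := 0) (T := T) le_rfl (by nlinarith)
  have i2 := integral_exp_affine_le hα.ne' (d := -(α * T)) (T := T) (by nlinarith) (by linarith)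
  rw [abs_neg, abs_of_pos hα] at h1 i1
  rw [abs_of_pos hα] at h2 i2
  have e : ∑ p ∈ Finset.range (N + 1),
        w p * (Real.exp (-α * (p * (T / N))) + Real.exp (-α * (T - p * (T / N))))
      = ∑ p ∈ Finset.range (N + 1), w p * Real.exp (0 + -α * (p * (T / N)))
        + ∑ p ∈ Finset.range (N + 1), w p * Real.exp (-(α * T) + α * (p * (T / N))) := by
    rw [← Finset.sum_add_distrib]
    refine Finset.sum_congr rfl fun p _ => ?_
    rw [mul_add]
    congr 3 <;> ring
  rw [e]
  linarith

end ChaosAdjoint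

theorem mainTheorem3
    {X : Type*} [NormedAddCommGroup X] [InnerProductSpace ℝ X] [FiniteDimensional ℝ X]
    [CompleteSpace X]
    (f : X → ℝ → X) (J : X → ℝ → ℝ) (s : ℝ) (k : ℕ) (hk : 1 ≤ k)
    (Λ : Set X) (Es Eu : X → Submodule ℝ X)
    (hf : ∀ x ∈ Λ, ContDiffAt ℝ (k + 1 : ℕ) (fun p : X × ℝ => f p.1 p.2) (x, s))
    (hJ : ∀ x ∈ Λ, ContDiffAt ℝ (k + 1 : ℕ) (fun p : X × ℝ => J p.1 p.2) (x, s))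
    (hyp : ChaosAdjoint.IsUniformlyHyperbolic (fun x => f x s) Λ Es Eu)
    (u : ℝ → X) (hu : ChaosAdjoint.IsOrbit (fun x => f x s) Λ u)
    (nu : ℕ) (hnu : Module.finrank ℝ (Eu (u 0)) = nu)
    (Jbar : ℝ)
    (hJbar : Tendsto (fun T : ℝ => (1 / T) * ∫ t in (0 : ℝ)..T, J (u t) s) atTop (𝓝 Jbar))
    (ψinf : ℝ → X) (hψ : ChaosAdjoint.IsAdjointShadowing f J s Es Eu u ψinf)
    (S : ChaosAdjoint.AdjointScheme X) (hS : S.HasOrder k f J s u)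
    (c : ℝ) (hc : 0 < c) (Cq : ℝ) :
    ∃ C₁ C₂ C₃ : ℝ, ∀ T : ℝ, 0 < T → ∃ δ : ℝ, 0 < δ ∧
      ∀ N : ℕ, 0 < N → T / N < δ →
        ∀ (M m : ℕ), nu ≤ m →
          ∀ P : ChaosAdjoint.StabilizedMarch f J s Jbar u S T N M nu m, P.Nondegenerate Es Eu c →
            ∀ w : ℕ → ℝ, ChaosAdjoint.IsQuadrature Cq k T N w →
              |ChaosAdjoint.discreteSensitivity f J s u T N w P.ψ
                  - ChaosAdjoint.continuousSensitivity f J s u T ψinf|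
                ≤ C₁ / T + (C₂ + C₃ * T) * (T / N) ^ k := by
  have hf' : ∀ x ∈ Λ, ContDiffAt ℝ (k + 1 : ℕ) (fun x => f x s) x := fun x hx =>
    ChaosAdjoint.contDiffAt_slice (hf x hx)
  have hJ' : ∀ x ∈ Λ, ContDiffAt ℝ (k + 1 : ℕ) (fun x => J x s) x := fun x hx =>
    ChaosAdjoint.contDiffAt_slice (hJ x hx)
  have hfs : ChaosAdjoint.BddDeriv k fun t => deriv (fun σ => f (u t) σ) s :=
    ChaosAdjoint.bddDeriv_comp_orbit hyp.compact hu (fun x hx => (hf' x hx).of_le (by simp))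
      fun x hx => ChaosAdjoint.contDiffAt_deriv_param (hf x hx)
  have hJs : ChaosAdjoint.BddDeriv k fun t => deriv (fun σ => J (u t) σ) s :=
    ChaosAdjoint.bddDeriv_comp_orbit hyp.compact hu (fun x hx => (hf' x hx).of_le (by simp))
      fun x hx => ChaosAdjoint.contDiffAt_deriv_param (hJ x hx)
  have hF : ChaosAdjoint.BddDeriv k fun t => ⟪ψinf t, deriv (fun σ => f (u t) σ) s⟫
      + deriv (fun σ => J (u t) σ) s :=
    (((hψ.bddDeriv hyp.compact hu hf' hJ').clm (ChaosAdjoint.innerL X)).clm_apply hfs).add hJs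
  obtain ⟨B, hB0, hB⟩ := hF.contDiffOn_Icc
  obtain ⟨Mf, hMf⟩ := hfs.bdd
  have hMf0 : 0 ≤ Mf := (norm_nonneg _).trans (hMf 0 le_rfl)
  obtain ⟨c₁, c₂, c₃, α, hc₁, hc₂, hc₃, hα, hmarch⟩ :=
    ChaosAdjoint.exists_march_error_bound (nu := nu) hk
    (fun x hx => (hf' x hx).of_le (by simp)) (fun x hx => (hJ' x hx).of_le (by simp))
    hyp hu hnu hJbar hψ hS hc
  refine ⟨Mf * c₁ * (2 * (1 / α)), Mf * c₁ * (2 * (|Cq| * (max 1 α) ^ k))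
    + Mf * (1 + |Cq|) * c₂ + |Cq| * B, Mf * (1 + |Cq|) * c₃, fun T hT => ?_⟩
  obtain ⟨δ, hδ0, hδ1, hδ⟩ := hmarch T hT
  refine ⟨δ, hδ0, fun N hN hlt M m hm P hP w hw => ?_⟩
  have hbound := hδ N hN hlt M m hm P hP
  have hNpos : (0 : ℝ) < N := by exact_mod_cast hN
  obtain ⟨hFc, hFb⟩ := hB T hT
  have hquad := hw.abs_error_le hT hFc hFb
  have hweights := hw.sum_weights_le hT (by positivity) (hlt.le.trans hδ1)
  have hlayers := hw.sum_layers_le hT hα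
  set h := T / (N : ℝ) with hh
  have hh0 : 0 < h := by positivity
  have hdiff : ChaosAdjoint.discreteSensitivity f J s u T N w P.ψ
        - ChaosAdjoint.continuousSensitivity f J s u T ψinf
      = (1 / T) * ((∑ p ∈ Finset.range (N + 1),
          w p * ⟪P.ψ p - ψinf (p * h), deriv (fun σ => f (u (p * h)) σ) s⟫)
        + ((∑ p ∈ Finset.range (N + 1), w p * (⟪ψinf (p * h), deriv (fun σ => f (u (p * h)) σ) s⟫
            + deriv (fun σ => J (u (p * h)) σ) s))
          - ∫ t in (0 : ℝ)..T, (⟪ψinf t, deriv (fun σ => f (u t) σ) s⟫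
            + deriv (fun σ => J (u t) σ) s))) := by
    rw [ChaosAdjoint.discreteSensitivity, ChaosAdjoint.continuousSensitivity, ← mul_sub,
      ← add_sub_assoc, ← Finset.sum_add_distrib]
    refine congrArg (fun z => 1 / T * (z - _)) (Finset.sum_congr rfl fun p _ => ?_)
    rw [inner_sub_left]
    ring
  have hsum : |∑ p ∈ Finset.range (N + 1),
      w p * ⟪P.ψ p - ψinf (p * h), deriv (fun σ => f (u (p * h)) σ) s⟫|
      ≤ Mf * (c₁ * (2 * (1 / α + |Cq| * T * (max 1 α) ^ k * h ^ k))
        + (c₂ + c₃ * T) * h ^ k * ((1 + |Cq|) * T)) := by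
    calc |∑ p ∈ Finset.range (N + 1),
          w p * ⟪P.ψ p - ψinf (p * h), deriv (fun σ => f (u (p * h)) σ) s⟫|
        ≤ ∑ p ∈ Finset.range (N + 1),
          w p * ((c₁ * (Real.exp (-α * (p * h)) + Real.exp (-α * (T - p * h)))
            + (c₂ + c₃ * T) * h ^ k) * Mf) := by
          refine (Finset.abs_sum_le_sum_abs _ _).trans (Finset.sum_le_sum fun p hp => ?_)
          have hpN : p ≤ N := by
            have := Finset.mem_range.1 hp; omega
          have hwp := hw.nonneg p hpN
          rw [abs_mul, abs_of_nonneg hwp]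
          gcongr
          refine (abs_real_inner_le_norm _ _).trans ?_
          have b1 := hbound p hpN
          have b2 := hMf (p * h) (by positivity)
          exact mul_le_mul b1 b2 (norm_nonneg _) ((norm_nonneg _).trans b1)
      _ = Mf * (c₁ * ∑ p ∈ Finset.range (N + 1),
            w p * (Real.exp (-α * (p * h)) + Real.exp (-α * (T - p * h)))
          + (c₂ + c₃ * T) * h ^ k * ∑ p ∈ Finset.range (N + 1), w p) := by
          rw [Finset.mul_sum, Finset.mul_sum, ← Finset.sum_add_distrib, Finset.mul_sum]
          exact Finset.sum_congr rfl fun p _ => by ring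
      _ ≤ _ := by gcongr
  rw [hdiff, abs_mul, abs_of_pos (by positivity : 0 < 1 / T)]
  refine (mul_le_mul_of_nonneg_left ((abs_add_le _ _).trans (add_le_add hsum hquad))
    (by positivity)).trans (le_of_eq ?_)
  field_simp
  ring
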